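/- Let $K$ be an algebraically closed field of characteristic $0$. For $d\in\mathbb Z$ let $G_d=\mathbb G_a\rtimes\mathbb G_m$ be the algebraic group over $K$ with group law $(b,t)\cdot(b',t')=(b+t^d b',\,tt')$. Consider algebraic left actions of $G_d$ on $\mathbb P^2=\mathbb P^2_K$ with homogeneous coordinates $(x:y:z)$, that is, group actions for which $G_d\times\mathbb P^2\to\mathbb P^2$ is a morphism of varieties. Such an action is *generically transitive* if it has a dense open orbit, and the *boundary* is then the complement of this orbit. Two actions of $G_d$ on $\mathbb P^2$ are *equivalent* if there are an automorphism $\alpha$ of the algebraic group $G_d$ and an automorphism $j$ of the variety $\mathbb P^2$ with $j(g\cdot p)=\alpha(g)\cdot j(p)$ for all $g\in G_d$, $p\in\mathbb P^2$, where the dot denotes the first action on the left side and the second action on the right side. For $k\in\mathbb Z\setminus\{0\}$ let $\tau_{d,k}$ be the action given by $$\tau_{d,k}(b,t)=\begin{pmatrix}t^k&0&0\\0&t^d&b\\0&0&1\end{pmatrix},$$ and for $d\ne0$ let $\rho_d$ be the action given by $$\rho_d(b,t)=\begin{pmatrix}t^{2d}&bt^d&b^2/2\\0&t^d&b\\0&0&1\end{pmatrix}$$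 (matrices acting on column vectors). **Theorem.** 1. Let $d\neq0$. For every faithful generically transitive action of $G_d$ on $\mathbb P^2$ exactly one of the following holds: (a) it is equivalent to $\tau_{d,k}$ for a unique integer $k\neq0$ with $\gcd(|k|,|d|)=1$, and it is not equivalent to $\rho_d$; or (b) it is equivalent to $\rho_d$, and it is not equivalent to $\tau_{d,k}$ for any integer $k\ne0$. 2. For every $d\neq0$ the action $\rho_d$ is generically transitive, and its boundary is the union of the line $\{z=0\}$ and the conic $\{y^2=2xz\}$, which is tangent to this line: they meet in the single point $(1:0:0)$. 3. Every faithful generically transitive action of $G_0$ on $\mathbb P^2$ is equivalent to $\tau_{0,1}$. -/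

import Mathlib

open scoped LinearAlgebra.Projectivization Matrix MatrixGroups

namespace GaGm

/-! ### The groups `G_d` -/

/-- The group `G_d = 𝔾ₐ ⋊ 𝔾ₘ` over `K`, as the set of pairs `(b, t)` with `b ∈ K`, `t ∈ Kˣ`.
The integer `d` enters through the group law. -/
@[ext]
structure Gd (K : Type*) [Field K] (d : ℤ) where
  b : K
  t : Kˣ

section Group

variable {K : Type*} [Field K] {d : ℤ}

instance : Mul (Gd K d) := ⟨fun g h => ⟨g.b + ((g.t ^ d : Kˣ) : K) * h.b, g.t * h.t⟩⟩

instance : One (Gd K d) := ⟨⟨0, 1⟩⟩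

instance : Inv (Gd K d) := ⟨fun g => ⟨-(((g.t ^ d)⁻¹ : Kˣ) : K) * g.b, g.t⁻¹⟩⟩

@[simp] theorem mul_b (g h : Gd K d) : (g * h).b = g.b + ((g.t ^ d : Kˣ) : K) * h.b := rfl
@[simp] theorem mul_t (g h : Gd K d) : (g * h).t = g.t * h.t := rfl
@[simp] theorem one_b : (1 : Gd K d).b = 0 := rfl
@[simp] theorem one_t : (1 : Gd K d).t = 1 := rfl
@[simp] theorem inv_b (g : Gd K d) : (g⁻¹).b = -(((g.t ^ d)⁻¹ : Kˣ) : K) * g.b := rfl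
@[simp] theorem inv_t (g : Gd K d) : (g⁻¹).t = g.t⁻¹ := rfl

/-- The group law `(b, t) (b', t') = (b + t ^ d b', t t')`. -/
instance : Group (Gd K d) :=
  Group.ofLeftAxioms
    (fun g h k => by ext <;> simp [mul_zpow] <;> ring)
    (fun g => by ext <;> simp)
    (fun g => by ext <;> simp)

end Group

section Regular

variable {K : Type*} [Field K] {d : ℤ}

/-- The closed embedding `(b, t) ↦ (b, t, t⁻¹)` of the variety `G_d` into affine 3-space. -/
def Gd.coords (g : Gd K d) : Fin 3 → K := ![g.b, (g.t : K), ((g.t⁻¹ : Kˣ) : K)]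

/-- Regular functions on the affine variety `G_d`: the polynomials in `b, t, t⁻¹`. -/
def IsRegularFun (f : Gd K d → K) : Prop :=
  ∃ P : MvPolynomial (Fin 3) K, ∀ g, f g = MvPolynomial.eval g.coords P

/-- A morphism from the affine variety `G_d` to itself: pull-back preserves regular functions. -/
def IsRegularSelfMap (φ : Gd K d → Gd K d) : Prop :=
  ∀ f : Gd K d → K, IsRegularFun f → IsRegularFun fun g => f (φ g)

end Regular

/-! ### The projective plane as a variety -/

/-- The set of `K`-points of the projective plane, with homogeneous coordinates `(x : y : z)`. -/
abbrev P2 (K : Type*) [Field K] := ℙ K (Fin 3 → K)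

section Plane

variable {K : Type*} [Field K] {d : ℤ}

/-- The Zariski topology on the projective plane: the complements of the plane curves (zero sets
of forms) are a basis of open sets. -/
@[reducible]
def zariski (K : Type*) [Field K] : TopologicalSpace (P2 K) :=
  TopologicalSpace.generateFrom
    {U | ∃ (n : ℕ) (F : MvPolynomial (Fin 3) K), F.IsHomogeneous n ∧
      U = {p : P2 K | MvPolynomial.eval p.rep F ≠ 0}}

/-- A morphism from the projective plane to itself: near each point it is given by three forms of
the same degree in `x, y, z` (without common zero near that point). -/
def IsRegularPlaneMap (j : P2 K → P2 K) : Prop :=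
  ∀ v₀ : Fin 3 → K, v₀ ≠ 0 →
    ∃ (n : ℕ) (F : Fin 3 → MvPolynomial (Fin 3) K),
      (∀ i, (F i).IsHomogeneous n) ∧
      (fun i => MvPolynomial.eval v₀ (F i)) ≠ 0 ∧
      ∀ (v : Fin 3 → K) (hv : v ≠ 0) (hF : (fun i => MvPolynomial.eval v (F i)) ≠ 0),
        j (Projectivization.mk K v hv) =
          Projectivization.mk K (fun i => MvPolynomial.eval v (F i)) hF

/-- The value at `(g, v)` of a polynomial in `x, y, z` whose coefficients are polynomials in
`b, t, t⁻¹`, that is, regular functions on `G_d`. -/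
noncomputable def evalAt (F : MvPolynomial (Fin 3) (MvPolynomial (Fin 3) K))
    (g : Gd K d) (v : Fin 3 → K) : K :=
  MvPolynomial.eval v (MvPolynomial.map (MvPolynomial.eval g.coords) F)

/-- A morphism `G_d × ℙ² → ℙ²` of varieties: near each point it is given by three polynomials
in `b, t, t⁻¹` and `x, y, z` which are homogeneous of the same degree in `x, y, z` (without common
zero near that point). -/
def IsRegularActionMap (m : Gd K d → P2 K → P2 K) : Prop :=
  ∀ (g₀ : Gd K d) (v₀ : Fin 3 → K), v₀ ≠ 0 →
    ∃ (n : ℕ) (F : Fin 3 → MvPolynomial (Fin 3) (MvPolynomial (Fin 3) K)),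
      (∀ i, (F i).IsHomogeneous n) ∧
      (fun i => evalAt (F i) g₀ v₀) ≠ 0 ∧
      ∀ (g : Gd K d) (v : Fin 3 → K) (hv : v ≠ 0) (hF : (fun i => evalAt (F i) g v) ≠ 0),
        m g (Projectivization.mk K v hv) = Projectivization.mk K (fun i => evalAt (F i) g v) hF

end Plane

/-! ### Algebraic actions of `G_d` on the plane -/

/-- An algebraic (left) action of `G_d` on the projective plane: a group action such that
`G_d × ℙ² → ℙ²` is a morphism of varieties. -/
structure AlgAction (K : Type*) [Field K] (d : ℤ) where
  toHom : Gd K d →* Equiv.Perm (P2 K)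
  regular : IsRegularActionMap fun g p => toHom g p

namespace AlgAction

variable {K : Type*} [Field K] {d : ℤ}

def Faithful (a : AlgAction K d) : Prop := Function.Injective a.toHom

/-- `U` is an orbit of the action which is open and dense in the Zariski topology. -/
def IsDenseOpenOrbit (a : AlgAction K d) (U : Set (P2 K)) : Prop :=
  @IsOpen (P2 K) (zariski K) U ∧ @Dense (P2 K) (zariski K) U ∧ ∃ p, U = Set.range fun g => a.toHom g p

/-- The action is transitive on some dense open subset. -/
def GenericallyTransitive (a : AlgAction K d) : Prop := ∃ U, a.IsDenseOpenOrbit U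

/-- Equivalence of actions: an automorphism `α` of the algebraic group `G_d` and an automorphism
`j` of the variety `ℙ²` with `j (g • p) = α g • j p`. -/
def Equivalent (a a' : AlgAction K d) : Prop :=
  ∃ (α : Gd K d ≃* Gd K d) (j : P2 K ≃ P2 K),
    IsRegularSelfMap α ∧ IsRegularSelfMap α.symm ∧
    IsRegularPlaneMap j ∧ IsRegularPlaneMap j.symm ∧
    ∀ g p, j (a.toHom g p) = a'.toHom (α g) (j p)

end AlgAction

/-! ### Linear actions and the actions `τ_{d,k}`, `ρ_d` -/

section Linear

variable {K : Type*} [Field K] {d : ℤ}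

theorem isRegularFun_const (c : K) : IsRegularFun fun _ : Gd K d => c :=
  ⟨MvPolynomial.C c, fun _ => by simp⟩

theorem isRegularFun_b : IsRegularFun fun g : Gd K d => g.b :=
  ⟨MvPolynomial.X 0, fun _ => by simp [Gd.coords]⟩

theorem IsRegularFun.mul {f f' : Gd K d → K} (h : IsRegularFun f) (h' : IsRegularFun f') :
    IsRegularFun fun g => f g * f' g := by
  obtain ⟨P, hP⟩ := h
  obtain ⟨P', hP'⟩ := h'
  exact ⟨P * P', fun g => by simp [hP, hP']⟩

theorem isRegularFun_t_zpow (k : ℤ) : IsRegularFun fun g : Gd K d => ((g.t ^ k : Kˣ) : K) := by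
  obtain ⟨n, rfl | rfl⟩ := k.eq_nat_or_neg
  · exact ⟨MvPolynomial.X 1 ^ n, fun g => by simp [Gd.coords]⟩
  · exact ⟨MvPolynomial.X 2 ^ n, fun g => by simp [Gd.coords]⟩

/-- The action on the plane of a matrix representation (by left multiplication on column
vectors). -/
noncomputable def linearHom (M : Gd K d →* Matrix (Fin 3) (Fin 3) K) :
    Gd K d →* Equiv.Perm (P2 K) :=
  (MulAction.toPermHom (GL (Fin 3) K) (P2 K)).comp M.toHomUnits

theorem linearHom_mk (M : Gd K d →* Matrix (Fin 3) (Fin 3) K) (g : Gd K d) (v : Fin 3 → K)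
    (hv : v ≠ 0) (h : M g *ᵥ v ≠ 0) :
    linearHom M g (Projectivization.mk K v hv) = Projectivization.mk K (M g *ᵥ v) h := rfl

theorem mulVec_ne_zero (M : Gd K d →* Matrix (Fin 3) (Fin 3) K) (g : Gd K d) (v : Fin 3 → K)
    (hv : v ≠ 0) : M g *ᵥ v ≠ 0 := by
  intro h
  apply hv
  have h1 : M g⁻¹ *ᵥ (M g *ᵥ v) = 0 := by rw [h, Matrix.mulVec_zero]
  rwa [Matrix.mulVec_mulVec, ← map_mul, inv_mul_cancel, map_one, Matrix.one_mulVec] at h1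

theorem linearHom_regular (M : Gd K d →* Matrix (Fin 3) (Fin 3) K)
    (hM : ∀ i j, IsRegularFun fun g => M g i j) :
    IsRegularActionMap fun g p => linearHom M g p := by
  choose P hP using hM
  have key : ∀ (g : Gd K d) (v : Fin 3 → K),
      (fun i => evalAt (∑ j, MvPolynomial.C (P i j) * MvPolynomial.X j) g v) = M g *ᵥ v := by
    intro g v
    funext i
    simp [evalAt, Matrix.mulVec, dotProduct, hP]
  intro g₀ v₀ hv₀
  refine ⟨1, fun i => ∑ j, MvPolynomial.C (P i j) * MvPolynomial.X j, fun i => ?_, ?_, ?_⟩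
  · refine MvPolynomial.IsHomogeneous.sum _ _ _ fun j _ => ?_
    simpa using (MvPolynomial.isHomogeneous_C (Fin 3) (P i j)).mul
      (MvPolynomial.isHomogeneous_X _ j)
  · rw [key]
    exact mulVec_ne_zero M g₀ v₀ hv₀
  · intro g v hv hF
    refine (linearHom_mk M g v hv (mulVec_ne_zero M g v hv)).trans ?_
    congr 1
    exact (key g v).symm

variable (K d)

/-- The matrix representation defining `τ_{d,k}`. -/
def tauMatrix (k : ℤ) : Gd K d →* Matrix (Fin 3) (Fin 3) K where
  toFun g := !![((g.t ^ k : Kˣ) : K), 0, 0;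
                0, ((g.t ^ d : Kˣ) : K), g.b;
                0, 0, 1]
  map_one' := by
    ext i j
    fin_cases i <;> fin_cases j <;> simp
  map_mul' g h := by
    ext i j
    fin_cases i <;> fin_cases j <;>
      simp [Matrix.mul_apply, Fin.sum_univ_three, mul_zpow, add_comm]

/-- The action `τ_{d,k}` of `G_d` on the plane. -/
noncomputable def tau (k : ℤ) : AlgAction K d where
  toHom := linearHom (tauMatrix K d k)
  regular := linearHom_regular _ fun i j => by
    fin_cases i <;> fin_cases j <;>
    first
    | exact isRegularFun_const 0
    | exact isRegularFun_const 1
    | exact isRegularFun_b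
    | exact isRegularFun_t_zpow _

/-- The matrix representation defining `ρ_d`. -/
def rhoMatrix [CharZero K] : Gd K d →* Matrix (Fin 3) (Fin 3) K where
  toFun g := !![((g.t ^ (2 * d) : Kˣ) : K), g.b * ((g.t ^ d : Kˣ) : K), g.b ^ 2 / 2;
                0, ((g.t ^ d : Kˣ) : K), g.b;
                0, 0, 1]
  map_one' := by
    ext i j
    fin_cases i <;> fin_cases j <;> simp
  map_mul' g h := by
    ext i j
    fin_cases i <;> fin_cases j <;>
      simp [Matrix.mul_apply, Fin.sum_univ_three, mul_zpow, two_mul, zpow_add₀] <;> ring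

/-- The action `ρ_d` of `G_d` on the plane. -/
noncomputable def rho [CharZero K] : AlgAction K d where
  toHom := linearHom (rhoMatrix K d)
  regular := linearHom_regular _ fun i j => by
    fin_cases i <;> fin_cases j <;>
    first
    | exact isRegularFun_const 0
    | exact isRegularFun_const 1
    | exact isRegularFun_b
    | exact isRegularFun_t_zpow _
    | exact isRegularFun_b.mul (isRegularFun_t_zpow _)
    | exact ⟨MvPolynomial.C (1 / 2) * MvPolynomial.X 0 ^ 2,
        fun g => by simp [rhoMatrix, Gd.coords]; ring⟩

variable {d}

/-- The line `z = 0`. -/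
def line : Set (P2 K) := {p | p.rep 2 = 0}

/-- The conic `y² = 2 x z`. -/
def conic : Set (P2 K) := {p | p.rep 1 ^ 2 = 2 * p.rep 0 * p.rep 2}

/-- The point `(1 : 0 : 0)`. -/
def pointX : P2 K :=
  Projectivization.mk K ![1, 0, 0] fun h => one_ne_zero (congrFun h 0)

end Linear

end GaGm

/-! Every automorphism of the plane is linear (`exists_isGivenBy`), so an action assigns to each
group element a matrix up to a scalar. The point is to remove the scalars along the two
one-parameter subgroups. Regularity of the action makes the images of a projective frame polynomial
in the parameter, hence also a representing matrix; dividing by the gcd of its entries gives a lift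
that never vanishes, and over an algebraically closed field such a lift is unique up to a constant.
Normalized to 1 at the identity it is multiplicative (`map_eval_translate`). So the unipotent
subgroup acts by exp(bN) with N³ = 0 (`AlgAction.exists_unipotent`), and the torus by a polynomial
matrix T(t) (`AlgAction.exists_torus_matrix`). Unipotent matrices have trace 3, which excludes a
scalar in the commutation relation and gives TN = t^d NT (`torus_mul_nilpotent`).

The coefficients of T project to weight spaces, and N shifts weights by d. Faithfulness gives N ≠ 0.
A Jordan basis of weight vectors yields τ when N² = 0 and ρ when N² ≠ 0
(`AlgAction.equivalent_rho_or_tau`).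

For uniqueness, an automorphism of G_d with d ≠ 0 preserves the unipotent subgroup, scales it, and
induces the identity on the torus quotient. An equivalence of models is then an intertwining matrix
whose entries can be compared. Roots of unity turn faithfulness of τ into the gcd condition, and k =
0 is excluded because then each orbit lies in a line. For d = 0 the torus acts trivially under ρ,
and inversion of the torus exchanges k = 1 and k = -1. -/

namespace GaGm

/-! ### Primitive families in a factorial domain -/

section Primitive

variable {R ι : Type*} [CommRing R]

/-- A family whose only common divisors are units. -/
def IsPrimitiveFamily (f : ι → R) : Prop := ∀ q, (∀ i, q ∣ f i) → IsUnit q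

variable [UniqueFactorizationMonoid R] [Fintype ι]

theorem exists_primitiveFamily (f : ι → R) (hf : f ≠ 0) :
    ∃ (p : R) (f' : ι → R), (∀ i, f i = p * f' i) ∧ IsPrimitiveFamily f' := by
  classical
  let _ : NormalizedGCDMonoid R := Classical.arbitrary _
  obtain ⟨i₀, hi₀⟩ := Function.ne_iff.mp hf
  obtain ⟨g, hg, hg1⟩ := Finset.extract_gcd (s := Finset.univ) f ⟨i₀, Finset.mem_univ _⟩
  refine ⟨_, g, fun i => hg i (Finset.mem_univ i), fun q hq => ?_⟩
  have : q ∣ Finset.univ.gcd g := Finset.dvd_gcd fun i _ => hq i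
  rw [hg1] at this
  exact isUnit_of_dvd_one this

/-- The cross relations say that `f j` divides every `f i * g j`, hence the gcd of these, which is
`g j` up to a unit because the gcd of `f` is a unit. -/
theorem IsPrimitiveFamily.exists_eq_mul [IsDomain R] {f g : ι → R} (hf : IsPrimitiveFamily f)
    (hfg : ∀ i j, f i * g j = f j * g i) : ∃ h, ∀ i, g i = h * f i := by
  classical
  let _ : NormalizedGCDMonoid R := Classical.arbitrary _
  by_cases h0 : ∀ i, f i = 0
  · have : IsUnit (0 : R) := hf 0 fun i => by rw [h0 i]
    have h01 := isUnit_zero_iff.mp this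
    exact ⟨0, fun i => by
      rw [zero_mul, ← one_mul (g i), ← h01, zero_mul]⟩
  · push Not at h0
    obtain ⟨j, hj⟩ := h0
    have h1 : f j ∣ Finset.univ.gcd fun i => f i * g j :=
      Finset.dvd_gcd fun i _ => ⟨g i, hfg i j⟩
    have h2 : IsUnit (Finset.univ.gcd f) := hf _ fun i => Finset.gcd_dvd (Finset.mem_univ i)
    have h3 : f j ∣ g j :=
      (h1.trans (Finset.gcd_mul_right' (s := Finset.univ) (f := f) (g j)).dvd).trans
        ((h2.mul_left_dvd).mpr dvd_rfl)
    obtain ⟨h, hh⟩ := h3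
    refine ⟨h, fun i => mul_left_cancel₀ hj ?_⟩
    rw [← hfg i j, hh]
    ring

end Primitive

/-! ### Automorphisms of the plane are linear -/

section PlaneMaps

open MvPolynomial

variable {K : Type*} [Field K]

theorem mk_eq_mk_iff_cross {v w : Fin 3 → K} (hv : v ≠ 0) (hw : w ≠ 0) :
    Projectivization.mk K v hv = Projectivization.mk K w hw ↔
      ∀ i j, v i * w j = v j * w i := by
  rw [Projectivization.mk_eq_mk_iff']
  constructor
  · rintro ⟨a, rfl⟩ i j
    simp only [Pi.smul_apply, smul_eq_mul]
    ring
  · intro h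
    obtain ⟨j, hj⟩ := Function.ne_iff.mp hw
    refine ⟨v j / w j, funext fun i => ?_⟩
    simp only [Pi.smul_apply, smul_eq_mul, Pi.zero_apply] at hj ⊢
    rw [div_mul_eq_mul_div, ← h i j, mul_div_cancel_right₀ _ hj]

/-- Take local forms at one point and divide by their gcd. Local forms at any other point are
proportional to the result, hence a polynomial multiple of it, so it cannot vanish where they do
not. -/
theorem exists_primitive_forms [Infinite K] {j : P2 K → P2 K} (hj : IsRegularPlaneMap j) :
    ∃ F : Fin 3 → MvPolynomial (Fin 3) K, IsPrimitiveFamily F ∧ ∀ (v : Fin 3 → K) (hv : v ≠ 0),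
      ∃ hF : (fun i => eval v (F i)) ≠ 0,
        j (Projectivization.mk K v hv) = Projectivization.mk K (fun i => eval v (F i)) hF := by
  have hv₀ : (![1, 0, 0] : Fin 3 → K) ≠ 0 := fun h => one_ne_zero (congrFun h 0)
  obtain ⟨n, F₀, -, hF₀, hjF₀⟩ := hj _ hv₀
  obtain ⟨l, hl⟩ := Function.ne_iff.mp hF₀
  have hl0 : F₀ l ≠ 0 := fun h => hl (by simp [h])
  obtain ⟨p, F, hpF, hF⟩ := exists_primitiveFamily F₀ fun h => hl0 (congrFun h l)
  refine ⟨F, hF, fun v₁ hv₁ => ?_⟩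
  obtain ⟨m, G, -, hG, hjG⟩ := hj v₁ hv₁
  obtain ⟨k, hk⟩ := Function.ne_iff.mp hG
  have hk0 : G k ≠ 0 := fun h => hk (by simp [h])
  have cross : ∀ i i', F i * G i' = F i' * G i := by
    intro i i'
    -- The extra factor vanishes at every vector where one of the two local descriptions may fail;
    -- `X 0` takes care of the zero vector.
    have : (F i * G i' - F i' * G i) * (F₀ l * G k * X 0) = 0 := by
      refine MvPolynomial.funext fun v => ?_
      by_cases hvl : eval v (F₀ l) = 0
      · simp [hvl]
      by_cases hvk : eval v (G k) = 0
      · simp [hvk]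
      by_cases hv0 : v 0 = 0
      · simp [hv0]
      have hv : v ≠ 0 := fun h => hv0 (congrFun h 0)
      have h1 : (fun i => eval v (F₀ i)) ≠ 0 := fun h => hvl (congrFun h l)
      have h2 : (fun i => eval v (G i)) ≠ 0 := fun h => hvk (congrFun h k)
      have h3 := (mk_eq_mk_iff_cross h1 h2).mp ((hjF₀ v hv h1).symm.trans (hjG v hv h2)) i i'
      simp only [hpF, map_mul] at h3 hvl
      have hp : eval v p ≠ 0 := left_ne_zero_of_mul hvl
      have : eval v (F i) * eval v (G i') = eval v (F i') * eval v (G i) := by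
        apply mul_left_cancel₀ hp
        linear_combination h3
      simp [this]
    have h4 : F₀ l * G k * X 0 ≠ 0 := mul_ne_zero (mul_ne_zero hl0 hk0) (X_ne_zero 0)
    exact sub_eq_zero.mp ((mul_eq_zero.mp this).resolve_right h4)
  obtain ⟨h, hh⟩ := hF.exists_eq_mul cross
  have hF1 : (fun i => eval v₁ (F i)) ≠ 0 := fun h0 => by
    apply hk
    have := congrFun h0 k
    simp only [Pi.zero_apply] at this ⊢
    rw [hh, map_mul, this, mul_zero]
  refine ⟨hF1, (hjG v₁ hv₁ hG).trans ?_⟩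
  rw [mk_eq_mk_iff_cross]
  intro i i'
  simp only [hh, map_mul]
  ring

theorem isPrimitiveFamily_X : IsPrimitiveFamily (X : Fin 3 → MvPolynomial (Fin 3) K) := by
  intro q hq
  have hp : Prime (X 0 : MvPolynomial (Fin 3) K) := X_prime
  have hrel : IsRelPrime (X 0 : MvPolynomial (Fin 3) K) (X 1) := by
    rw [hp.irreducible.isRelPrime_iff_not_dvd, X_dvd_X]
    simp
  exact hrel (hq 0) (hq 1)

theorem eval_bind₁ (f : Fin 3 → MvPolynomial (Fin 3) K) (p : MvPolynomial (Fin 3) K)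
    (v : Fin 3 → K) : eval v (bind₁ f p) = eval (fun k => eval v (f k)) p :=
  eval₂Hom_bind₁ (RingHom.id K) v f p

theorem coeff_bind₁_C_mul_X {R σ} [CommSemiring R] (a : R) (p : MvPolynomial σ R) (m : σ →₀ ℕ) :
    coeff m (bind₁ (fun i => C a * X i) p) = a ^ m.degree * coeff m p := by
  classical
  induction p using MvPolynomial.induction_on' with
  | monomial d r =>
    have : bind₁ (fun i => C a * X i) (monomial d r) = monomial d (a ^ d.degree * r) := by
      rw [bind₁_monomial, monomial_eq, Finsupp.degree_apply]
      simp only [mul_pow, Finset.prod_mul_distrib, ← C_pow, Finsupp.prod, C_mul, ← map_prod,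
        Finset.prod_pow_eq_pow_sum]
      ring
    rw [this, coeff_monomial, coeff_monomial]
    split_ifs with h
    · rw [h]
    · simp
  | add p q hp hq => simp [hp, hq, mul_add]

variable [IsAlgClosed K]

/-- By the Nullstellensatz `H` divides a power of each variable, and powers of two different
variables are coprime. -/
theorem isUnit_of_eval_ne_zero {H : MvPolynomial (Fin 3) K}
    (hH : ∀ v : Fin 3 → K, v ≠ 0 → eval v H ≠ 0) : IsUnit H := by
  have key : ∀ i, ∃ n, H ∣ (X i : MvPolynomial (Fin 3) K) ^ n := by
    intro i
    have h1 : (X i : MvPolynomial (Fin 3) K) ∈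
        vanishingIdeal K (zeroLocus K (Ideal.span {H})) := by
      rw [mem_vanishingIdeal_iff]
      intro v hv
      have h2 : eval v H = 0 := by
        simpa [aeval_eq_eval] using (mem_zeroLocus_iff.mp hv) H (Ideal.mem_span_singleton_self H)
      have h3 : v = 0 := by
        by_contra h
        exact hH v h h2
      simp [h3]
    rw [vanishingIdeal_zeroLocus_eq_radical] at h1
    obtain ⟨n, hn⟩ := h1
    exact ⟨n, Ideal.mem_span_singleton.mp hn⟩
  obtain ⟨n, hn⟩ := key 0
  obtain ⟨m, hm⟩ := key 1
  have hp : Prime (X 0 : MvPolynomial (Fin 3) K) := X_prime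
  have hrel : IsRelPrime ((X 0 : MvPolynomial (Fin 3) K) ^ n) (X 1 ^ m) := by
    apply IsRelPrime.pow
    rw [hp.irreducible.isRelPrime_iff_not_dvd, X_dvd_X]
    simp
  exact hrel hn hm

theorem exists_C_of_eval_ne_zero {H : MvPolynomial (Fin 3) K}
    (hH : ∀ v : Fin 3 → K, v ≠ 0 → eval v H ≠ 0) : ∃ c : K, c ≠ 0 ∧ H = C c := by
  obtain ⟨c, hc, hc'⟩ := isUnit_iff_eq_C_of_isReduced.mp (isUnit_of_eval_ne_zero hH)
  exact ⟨c, hc.ne_zero, hc'⟩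

/-- Primitivity gives F(2v) = h(v)F(v) with h free of zeros off the origin, hence constant. Each
monomial of F of degree m then satisfies 2^m = h, and in characteristic 0 this determines m. -/
theorem isHomogeneous_of_scaling [CharZero K] {F : Fin 3 → MvPolynomial (Fin 3) K}
    (hF : ∀ v : Fin 3 → K, v ≠ 0 → (fun i => eval v (F i)) ≠ 0)
    (hprim : IsPrimitiveFamily F)
    (hs : ∀ v : Fin 3 → K, v ≠ 0 → ∀ i j,
      eval ((2 : K) • v) (F i) * eval v (F j) = eval ((2 : K) • v) (F j) * eval v (F i)) :
    ∃ n, ∀ i, (F i).IsHomogeneous n := by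
  set S : Fin 3 → MvPolynomial (Fin 3) K := fun i => bind₁ (fun i => C 2 * X i) (F i) with hS
  have hSe : ∀ v i, eval v (S i) = eval ((2 : K) • v) (F i) := by
    intro v i
    have : (2 : K) • v = fun i => eval v (C 2 * X i) := by
      funext i
      simp
    rw [this, hS]
    simp only [eval_bind₁]
  have cross : ∀ i j, F i * S j = F j * S i := by
    intro i j
    refine MvPolynomial.funext fun v => ?_
    simp only [map_mul, hSe]
    rcases eq_or_ne v 0 with rfl | hv
    · simp only [smul_zero]
      ring
    · linear_combination -hs v hv i j
  obtain ⟨h, hh⟩ := hprim.exists_eq_mul cross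
  obtain ⟨q, -, rfl⟩ : ∃ c : K, c ≠ 0 ∧ h = C c := by
    refine exists_C_of_eval_ne_zero fun v hv h0 => hF ((2 : K) • v) (by simpa using hv) ?_
    funext i
    rw [← hSe, hh, map_mul, h0, zero_mul, Pi.zero_apply]
  have hco : ∀ i m, coeff m (F i) ≠ 0 → (2 : K) ^ m.degree = q := by
    intro i m hm
    have := congrArg (coeff m) (hh i)
    rw [hS] at this
    simp only [coeff_bind₁_C_mul_X, coeff_C_mul] at this
    exact mul_right_cancel₀ hm this
  obtain ⟨i₀, hi₀⟩ := Function.ne_iff.mp (hF ![1, 0, 0] fun h => one_ne_zero (congrFun h 0))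
  obtain ⟨m₀, hm₀⟩ := ne_zero_iff.mp (fun h => hi₀ (by simp [h]) : F i₀ ≠ 0)
  refine ⟨m₀.degree, fun i m hm => ?_⟩
  have h1 : (2 : K) ^ m.degree = 2 ^ m₀.degree := (hco i m hm).trans (hco i₀ m₀ hm₀).symm
  have h2 : (2 : ℕ) ^ m.degree = 2 ^ m₀.degree := by exact_mod_cast h1
  rw [← Nat.pow_right_injective le_rfl h2, Finsupp.degree_eq_weight_one]
  rfl

theorem exists_primitive_homogeneous_forms [CharZero K] {j : P2 K → P2 K}
    (hj : IsRegularPlaneMap j) :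
    ∃ (n : ℕ) (F : Fin 3 → MvPolynomial (Fin 3) K), (∀ i, (F i).IsHomogeneous n) ∧
      ∀ (v : Fin 3 → K) (hv : v ≠ 0), ∃ hF : (fun i => eval v (F i)) ≠ 0,
        j (Projectivization.mk K v hv) = Projectivization.mk K (fun i => eval v (F i)) hF := by
  obtain ⟨F, hprim, hF⟩ := exists_primitive_forms hj
  obtain ⟨n, hn⟩ := isHomogeneous_of_scaling (fun v hv => (hF v hv).1) hprim fun v hv i k => by
    have h2 : (2 : K) • v ≠ 0 := by simpa using hv
    obtain ⟨h, h'⟩ := hF v hv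
    obtain ⟨g, g'⟩ := hF _ h2
    refine (mk_eq_mk_iff_cross g h).mp ?_ i k
    rw [← h', ← g']
    congr 1
    rw [Projectivization.mk_eq_mk_iff']
    exact ⟨2, rfl⟩
  exact ⟨n, F, hn, hF⟩

/-- The self-map of the plane `j` is given by the matrix `A`. -/
def IsGivenBy (j : P2 K → P2 K) (A : Matrix (Fin 3) (Fin 3) K) : Prop :=
  ∀ (v : Fin 3 → K) (hv : v ≠ 0), ∃ h : A *ᵥ v ≠ 0,
    j (Projectivization.mk K v hv) = Projectivization.mk K (A *ᵥ v) h

/-- An automorphism of the projective plane is given by a matrix. -/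
theorem exists_isGivenBy [CharZero K] (j : P2 K ≃ P2 K) (hj : IsRegularPlaneMap j)
    (hj' : IsRegularPlaneMap j.symm) : ∃ A, IsGivenBy j A := by
  obtain ⟨n, F, hn, hF⟩ := exists_primitive_homogeneous_forms hj
  obtain ⟨m, G, hm, hG⟩ := exists_primitive_homogeneous_forms hj'
  set D : Fin 3 → MvPolynomial (Fin 3) K := fun i => bind₁ F (G i) with hD
  have hDe : ∀ v i, eval v (D i) = eval (fun k => eval v (F k)) (G i) := by
    intro v i
    rw [hD]
    simp only [eval_bind₁]
  have hDv : ∀ (v : Fin 3 → K) (hv : v ≠ 0), ∃ h : (fun i => eval v (D i)) ≠ 0,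
      Projectivization.mk K v hv = Projectivization.mk K (fun i => eval v (D i)) h := by
    intro v hv
    obtain ⟨h, h'⟩ := hF v hv
    obtain ⟨g, g'⟩ := hG _ h
    simp only [hDe]
    refine ⟨g, ?_⟩
    rw [← g', ← h', Equiv.symm_apply_apply]
  -- `D`, the composite of the two families of forms, represents the identity. So it is a constant
  -- multiple of the coordinates, and the product of the degrees `n` and `m` is 1.
  have cross : ∀ i k, (X i : MvPolynomial (Fin 3) K) * D k = X k * D i := by
    intro i k
    refine MvPolynomial.funext fun v => ?_
    rcases eq_or_ne v 0 with rfl | hv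
    · simp
    obtain ⟨h, h'⟩ := hDv v hv
    simpa using (mk_eq_mk_iff_cross hv h).mp h' i k
  obtain ⟨H, hH⟩ := isPrimitiveFamily_X.exists_eq_mul cross
  obtain ⟨c, hc, rfl⟩ : ∃ c : K, c ≠ 0 ∧ H = C c := by
    refine exists_C_of_eval_ne_zero fun v hv h0 => (hDv v hv).1 ?_
    funext i
    rw [hH, map_mul, h0, zero_mul, Pi.zero_apply]
  have hn1 : n = 1 := by
    have h1 : (D 0).IsHomogeneous (n * m) := (hm 0).aeval F hn
    have h2 : (D 0).IsHomogeneous 1 := by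
      rw [hH]
      exact isHomogeneous_C_mul_X c 0
    have h3 : D 0 ≠ 0 := by
      rw [hH]
      exact mul_ne_zero (by simpa using hc) (X_ne_zero 0)
    exact Nat.eq_one_of_mul_eq_one_right (h1.inj_right h2 h3)
  subst hn1
  have hlin : ∀ i, ∃ a : Fin 3 → K, ∑ k, a k • (X k : MvPolynomial (Fin 3) K) = F i := by
    intro i
    rw [← Submodule.mem_span_range_iff_exists_fun, ← homogeneousSubmodule_one_eq_span_X]
    exact hn i
  choose A hA using hlin
  have hAv : ∀ v, (fun i => eval v (F i)) = Matrix.of A *ᵥ v := by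
    intro v
    funext i
    simp [← hA, Matrix.mulVec, dotProduct, smul_eval]
  refine ⟨Matrix.of A, fun v hv => ?_⟩
  have := hF v hv
  simpa only [hAv] using this

end PlaneMaps

/-! ### Matrices representing self-maps of the plane -/

section GivenBy

variable {K : Type*} [Field K]

theorem IsGivenBy.det_ne_zero {j : P2 K → P2 K} {A : Matrix (Fin 3) (Fin 3) K}
    (h : IsGivenBy j A) : A.det ≠ 0 := by
  intro h0
  obtain ⟨v, hv, hv0⟩ := Matrix.exists_mulVec_eq_zero_iff.mpr h0
  exact (h v hv).1 hv0

theorem IsGivenBy.of_smul {j : P2 K → P2 K} {A : Matrix (Fin 3) (Fin 3) K} {c : K} (hc : c ≠ 0)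
    (h : IsGivenBy j A) : IsGivenBy j (c • A) := by
  intro v hv
  obtain ⟨h1, h2⟩ := h v hv
  have h3 : (c • A) *ᵥ v ≠ 0 := by
    rw [Matrix.smul_mulVec]
    exact smul_ne_zero hc h1
  refine ⟨h3, h2.trans ?_⟩
  rw [Projectivization.mk_eq_mk_iff']
  refine ⟨c⁻¹, ?_⟩
  rw [Matrix.smul_mulVec, inv_smul_smul₀ hc]

theorem IsGivenBy.comp {j j' : P2 K → P2 K} {A B : Matrix (Fin 3) (Fin 3) K}
    (h : IsGivenBy j A) (h' : IsGivenBy j' B) : IsGivenBy (fun p => j (j' p)) (A * B) := by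
  intro v hv
  obtain ⟨h1, h2⟩ := h' v hv
  obtain ⟨h3, h4⟩ := h _ h1
  simp only [← Matrix.mulVec_mulVec]
  exact ⟨h3, by rw [h2, h4]⟩

theorem IsGivenBy.ext {j j' : P2 K → P2 K} {A : Matrix (Fin 3) (Fin 3) K}
    (h : IsGivenBy j A) (h' : IsGivenBy j' A) : j = j' := by
  funext p
  induction p using Projectivization.ind with
  | h v hv => rw [(h v hv).2, (h' v hv).2]

theorem isGivenBy_one : IsGivenBy (fun p : P2 K => p) 1 := by
  intro v hv
  simp only [Matrix.one_mulVec]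
  exact ⟨hv, trivial⟩

/-- The representing matrix is unique up to a scalar. -/
theorem IsGivenBy.exists_smul {j : P2 K → P2 K} {A B : Matrix (Fin 3) (Fin 3) K}
    (hA : IsGivenBy j A) (hB : IsGivenBy j B) : ∃ c : K, c ≠ 0 ∧ B = c • A := by
  have key : ∀ v : Fin 3 → K, v ≠ 0 → ∃ c : K, c ≠ 0 ∧ B *ᵥ v = c • A *ᵥ v := by
    intro v hv
    obtain ⟨h1, h2⟩ := hA v hv
    obtain ⟨h3, h4⟩ := hB v hv
    obtain ⟨c, hc⟩ := (Projectivization.mk_eq_mk_iff' K _ _ h3 h1).mp (h4.symm.trans h2)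
    refine ⟨c, fun h0 => h3 ?_, hc.symm⟩
    rw [← hc, h0, zero_smul]
  have hs : ∀ k : Fin 3, (Pi.single k 1 : Fin 3 → K) ≠ 0 := fun k => by simp
  -- The basis vectors give B = A·diag(μ); the all-ones vector, the fourth point of the frame,
  -- forces the entries of μ to coincide.
  choose μ hμ hμ' using fun k => key _ (hs k)
  obtain ⟨c, hc, hc'⟩ := key (fun _ => 1) (fun h => one_ne_zero (congrFun h 0))
  have hBA : ∀ i k, B i k = μ k * A i k := fun i k => by
    simpa using congrFun (hμ' k) i
  have h0 : A *ᵥ (fun k => μ k - c) = 0 := by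
    funext i
    have := congrFun hc' i
    simp only [Matrix.mulVec, dotProduct, mul_one, hBA, Pi.smul_apply, smul_eq_mul,
      Fin.sum_univ_three, Pi.zero_apply] at this ⊢
    linear_combination this
  have h1 : (fun k => μ k - c) = 0 := by
    by_contra h
    exact hA.det_ne_zero (Matrix.exists_mulVec_eq_zero_iff.mp ⟨_, h, h0⟩)
  refine ⟨c, hc, ?_⟩
  ext i k
  rw [hBA, Matrix.smul_apply, smul_eq_mul, sub_eq_zero.mp (congrFun h1 k)]

end GivenBy

/-! ### Projectivities determined by the images of four points -/

section FourPoints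

variable {R : Type*} [CommRing R]

/-- The matrix, unique up to a scalar, of the projectivity which maps the standard frame to the
points represented by the columns of `M` and by `q`. -/
def frameMatrix (M : Matrix (Fin 3) (Fin 3) R) (q : Fin 3 → R) : Matrix (Fin 3) (Fin 3) R :=
  M * Matrix.diagonal fun k => (M.updateCol k q).det

theorem frameMatrix_map {S : Type*} [CommRing S] (f : R →+* S) (M : Matrix (Fin 3) (Fin 3) R)
    (q : Fin 3 → R) : (frameMatrix M q).map f = frameMatrix (M.map f) (f ∘ q) := by
  rw [frameMatrix, frameMatrix, Matrix.map_mul, Matrix.diagonal_map (map_zero f)]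
  congr 2
  funext k
  rw [← Matrix.map_updateCol, RingHom.map_det]
  rfl

variable {K : Type*} [Field K]

/-- The hypotheses say A = M·diag(μ) and Mμ = νq. Cramer's rule solves the last equation, so μ is
proportional to the vector of determinants used in `frameMatrix`, an expression polynomial in M and
q. -/
theorem frameMatrix_eq_smul {A M : Matrix (Fin 3) (Fin 3) K} {q μ : Fin 3 → K} {ν : K}
    (hA : A.det ≠ 0) (hν : ν ≠ 0) (hAM : ∀ i k, A i k = μ k * M i k)
    (hAq : A *ᵥ (fun _ => 1) = ν • q) : ∃ c : K, c ≠ 0 ∧ frameMatrix M q = c • A := by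
  have hAM' : A = M * Matrix.diagonal μ := by
    ext i k
    rw [Matrix.mul_diagonal, hAM, mul_comm]
  have hM : M.det ≠ 0 := fun h => hA (by rw [hAM', Matrix.det_mul, h, zero_mul])
  have h1 : M *ᵥ (M.cramer q - (M.det / ν) • μ) = 0 := by
    have h2 : M *ᵥ μ = ν • q := by
      rw [← hAq, hAM', ← Matrix.mulVec_mulVec]
      congr 1
      funext k
      simp [Matrix.mulVec_diagonal]
    rw [Matrix.mulVec_sub, Matrix.mulVec_smul, h2, Matrix.mulVec_cramer, smul_smul,
      div_mul_cancel₀ _ hν, sub_self]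
  have h3 : M.cramer q = (M.det / ν) • μ := by
    by_contra h
    exact hM (Matrix.exists_mulVec_eq_zero_iff.mp ⟨_, sub_ne_zero.mpr h, h1⟩)
  refine ⟨M.det / ν, div_ne_zero hM hν, ?_⟩
  ext i k
  have := congrFun h3 k
  rw [Matrix.cramer_apply] at this
  rw [frameMatrix, Matrix.mul_diagonal, this, Matrix.smul_apply, hAM]
  simp only [Pi.smul_apply, smul_eq_mul]
  ring

/-- One determinant thus detects that all four vectors represent points. -/
theorem ne_zero_of_det_frameMatrix_ne_zero {M : Matrix (Fin 3) (Fin 3) K} {q : Fin 3 → K}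
    (h : (frameMatrix M q).det ≠ 0) : q ≠ 0 ∧ ∀ k, M.col k ≠ 0 := by
  constructor
  · rintro rfl
    apply h
    rw [frameMatrix, Matrix.det_mul, Matrix.det_diagonal]
    simp [← Matrix.cramer_apply]
  · intro k hk
    apply h
    rw [frameMatrix, Matrix.det_mul, Matrix.det_eq_zero_of_column_eq_zero k fun i => congrFun hk i,
      zero_mul]

end FourPoints

/-! ### Restriction of an action to a rational curve in the group -/

section Curves

open Polynomial

variable {K : Type*} [Field K] {d : ℤ} {ι : Type*}

/-- Regular functions on `G_d` restrict to polynomials on the curve `c`, up to factors without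
zeros. -/
def IsPolynomialCurve (x : ι → K) (c : ι → Gd K d) : Prop :=
  ∀ P : Fin 3 → MvPolynomial (Fin 3) K, ∃ (u : ι → K) (Q : Fin 3 → K[X]),
    ∀ s, u s ≠ 0 ∧ ∀ i, (Q i).eval (x s) = u s * MvPolynomial.eval (c s).coords (P i)

theorem AlgAction.isRegularPlaneMap (a : AlgAction K d) (g : Gd K d) :
    IsRegularPlaneMap (a.toHom g) := by
  intro v₀ hv₀
  obtain ⟨n, F, hn, h0, h⟩ := a.regular g v₀ hv₀
  exact ⟨n, fun i => MvPolynomial.map (MvPolynomial.eval g.coords) (F i), fun i => (hn i).map _,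
    h0, fun v hv hF => h g v hv hF⟩

theorem AlgAction.exists_isGivenBy [IsAlgClosed K] [CharZero K] (a : AlgAction K d)
    (g : Gd K d) : ∃ A, IsGivenBy (a.toHom g) A := by
  refine GaGm.exists_isGivenBy (a.toHom g) (a.isRegularPlaneMap g) ?_
  have : (a.toHom g).symm = a.toHom g⁻¹ := by rw [map_inv]; rfl
  rw [this]
  exact a.isRegularPlaneMap g⁻¹

theorem AlgAction.exists_polynomial_point (a : AlgAction K d) {x : ι → K} {c : ι → Gd K d}
    (hc : IsPolynomialCurve x c) (s₀ : ι) (v : Fin 3 → K) (hv : v ≠ 0) :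
    ∃ q : Fin 3 → K[X], (fun i => (q i).eval (x s₀)) ≠ 0 ∧
      ∀ (s : ι) (h : (fun i => (q i).eval (x s)) ≠ 0),
        a.toHom (c s) (Projectivization.mk K v hv) = Projectivization.mk K _ h := by
  obtain ⟨n, F, -, h0, h⟩ := a.regular (c s₀) v hv
  obtain ⟨u, Q, hQ⟩ := hc fun i => MvPolynomial.eval (MvPolynomial.C ∘ v) (F i)
  have key : ∀ s, (fun i => (Q i).eval (x s)) = u s • fun i => evalAt (F i) (c s) v := by
    intro s
    funext i
    rw [(hQ s).2 i, Pi.smul_apply, smul_eq_mul, evalAt, MvPolynomial.map_eval]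
    congr 3
    funext k
    simp
  refine ⟨Q, ?_, fun s hs => ?_⟩
  · rw [key]
    exact smul_ne_zero (hQ s₀).1 h0
  · have h1 : (fun i => evalAt (F i) (c s) v) ≠ 0 := fun h2 => hs (by rw [key, h2, smul_zero])
    refine (h (c s) v hv h1).trans ?_
    rw [eq_comm, Projectivization.mk_eq_mk_iff']
    exact ⟨u s, (key s).symm⟩

/-- Near a parameter value the images of the four frame points are polynomial vectors, and each
group element acts linearly, so the frame matrix of these vectors represents the action. -/
theorem AlgAction.exists_local_matrix [IsAlgClosed K] [CharZero K] (a : AlgAction K d) {x : ι → K}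
    {c : ι → Gd K d} (hc : IsPolynomialCurve x c) (s₀ : ι) :
    ∃ B : Matrix (Fin 3) (Fin 3) K[X], (B.map (eval (x s₀))).det ≠ 0 ∧
      ∀ s, (B.map (eval (x s))).det ≠ 0 → IsGivenBy (a.toHom (c s)) (B.map (eval (x s))) := by
  have hs : ∀ k : Fin 3, (Pi.single k 1 : Fin 3 → K) ≠ 0 := fun k => by simp
  have h1 : (fun _ => 1 : Fin 3 → K) ≠ 0 := fun h => one_ne_zero (congrFun h 0)
  choose M hM hM' using fun k => a.exists_polynomial_point hc s₀ _ (hs k)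
  obtain ⟨q, hq, hq'⟩ := a.exists_polynomial_point hc s₀ _ h1
  have hmap : ∀ s, (frameMatrix (Matrix.of fun i k => M k i) q).map (eval (x s)) =
      frameMatrix (Matrix.of fun i k => (M k i).eval (x s)) fun i => (q i).eval (x s) :=
    fun s => frameMatrix_map (evalRingHom (x s)) _ _
  have key : ∀ s, (fun i => (q i).eval (x s)) ≠ 0 → (∀ k, (fun i => (M k i).eval (x s)) ≠ 0) →
      IsGivenBy (a.toHom (c s)) (frameMatrix (Matrix.of fun i k => (M k i).eval (x s))
        fun i => (q i).eval (x s)) := by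
    intro s h2 h3
    obtain ⟨A, hA⟩ := a.exists_isGivenBy (c s)
    have h4 : ∀ k, ∃ μ : K, ∀ i, A i k = μ * (M k i).eval (x s) := by
      intro k
      obtain ⟨h5, h6⟩ := hA _ (hs k)
      obtain ⟨μ, hμ⟩ := (Projectivization.mk_eq_mk_iff' K _ _ h5 (h3 k)).mp
        (h6.symm.trans (hM' k s (h3 k)))
      refine ⟨μ, fun i => ?_⟩
      simpa using (congrFun hμ i).symm
    choose μ hμ' using h4
    obtain ⟨h5, h6⟩ := hA _ h1
    obtain ⟨ν, hν⟩ := (Projectivization.mk_eq_mk_iff' K _ _ h5 h2).mp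
      (h6.symm.trans (hq' s h2))
    obtain ⟨e, he, he'⟩ := frameMatrix_eq_smul (M := Matrix.of fun i k => (M k i).eval (x s))
      hA.det_ne_zero (fun h0 => h5 (by rw [← hν, h0, zero_smul])) (fun i k => hμ' k i) hν.symm
    rw [he']
    exact hA.of_smul he
  refine ⟨frameMatrix (Matrix.of fun i k => M k i) q, ?_, fun s h => ?_⟩
  · rw [hmap]
    exact (key s₀ hq hM).det_ne_zero
  · rw [hmap] at h ⊢
    obtain ⟨h2, h3⟩ := ne_zero_of_det_frameMatrix_ne_zero h
    exact key s h2 h3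

theorem eq_zero_of_forall_eval_eq_zero [Infinite ι] {x : ι → K} (hx : Function.Injective x)
    {p : K[X]} (hp : ∀ s, p.eval (x s) = 0) : p = 0 := by
  refine eq_zero_of_infinite_isRoot p ((Set.infinite_range_of_injective hx).mono ?_)
  rintro _ ⟨s, rfl⟩
  exact hp s

theorem det_map_eval (B : Matrix (Fin 3) (Fin 3) K[X]) (x : K) :
    (B.map (eval x)).det = B.det.eval x :=
  ((evalRingHom x).map_det B).symm

theorem isGivenBy_cross {j : P2 K → P2 K} {A B : Matrix (Fin 3) (Fin 3) K} (hA : IsGivenBy j A)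
    (hB : IsGivenBy j B) (p q : Fin 3 × Fin 3) :
    A p.1 p.2 * B q.1 q.2 = A q.1 q.2 * B p.1 p.2 := by
  obtain ⟨c, -, rfl⟩ := hA.exists_smul hB
  simp only [Matrix.smul_apply, smul_eq_mul]
  ring

/-- Along a polynomial curve, an action is given by a primitive matrix of polynomials. -/
theorem AlgAction.exists_primitive_matrix [IsAlgClosed K] [CharZero K] [Infinite ι] [Nonempty ι]
    (a : AlgAction K d) {x : ι → K} (hx : Function.Injective x) {c : ι → Gd K d}
    (hc : IsPolynomialCurve x c) :
    ∃ B : Matrix (Fin 3) (Fin 3) K[X],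
      IsPrimitiveFamily (fun p : Fin 3 × Fin 3 => B p.1 p.2) ∧
      ∀ s, IsGivenBy (a.toHom (c s)) (B.map (eval (x s))) := by
  obtain ⟨s₀⟩ := ‹Nonempty ι›
  obtain ⟨B₀, h0, hB₀⟩ := a.exists_local_matrix hc s₀
  obtain ⟨p, f, hpf, hf⟩ := exists_primitiveFamily (fun p : Fin 3 × Fin 3 => B₀ p.1 p.2) (by
    intro h
    apply h0
    have : B₀ = 0 := by
      ext1 i k
      exact congrFun h (i, k)
    rw [det_map_eval, this]
    simp)
  set B : Matrix (Fin 3) (Fin 3) K[X] := Matrix.of fun i k => f (i, k) with hB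
  have hpB : ∀ i k, B₀ i k = p * B i k := fun i k => hpf (i, k)
  refine ⟨B, hf, fun s₁ => ?_⟩
  obtain ⟨B₁, h1, hB₁⟩ := a.exists_local_matrix hc s₁
  have cross : ∀ i k, f i * B₁ k.1 k.2 = f k * B₁ i.1 i.2 := by
    intro i k
    have h2 : (f i * B₁ k.1 k.2 - f k * B₁ i.1 i.2) * (B₀.det * B₁.det * p) = 0 := by
      refine eq_zero_of_forall_eval_eq_zero hx fun s => ?_
      by_cases h3 : B₀.det.eval (x s) = 0
      · simp [h3]
      by_cases h4 : B₁.det.eval (x s) = 0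
      · simp [h4]
      have h5 := isGivenBy_cross (hB₀ s (by rwa [det_map_eval])) (hB₁ s (by rwa [det_map_eval])) i k
      simp only [Matrix.map_apply, hpf, eval_mul] at h5
      simp only [eval_mul, eval_sub]
      linear_combination (B₀.det.eval (x s) * B₁.det.eval (x s)) * h5
    have h3 : B₀.det ≠ 0 := fun h => h0 (by rw [det_map_eval, h, eval_zero])
    have h4 : B₁.det ≠ 0 := fun h => h1 (by rw [det_map_eval, h, eval_zero])
    have h5 : p ≠ 0 := fun h => h3 (by
      have : B₀ = 0 := by
        ext1 i k
        rw [hpB, h, zero_mul, Matrix.zero_apply]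
      rw [this]
      simp)
    exact sub_eq_zero.mp ((mul_eq_zero.mp h2).resolve_right (mul_ne_zero (mul_ne_zero h3 h4) h5))
  -- The local matrix at `s₁` is a multiple of the primitive one, which is therefore invertible
  -- there as well and represents the same map.
  obtain ⟨h, hh⟩ := hf.exists_eq_mul cross
  have hBs : B₁.map (eval (x s₁)) = h.eval (x s₁) • B.map (eval (x s₁)) := by
    ext i k
    simp [hh (i, k), hB]
  have hne : h.eval (x s₁) ≠ 0 := fun h0 => h1 (by
    rw [hBs, h0, zero_smul]
    simp)
  have := (hB₁ s₁ h1).of_smul (inv_ne_zero hne)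
  rwa [hBs, inv_smul_smul₀ hne] at this

end Curves

/-! ### One-parameter subgroups -/

section OneParameter

open Polynomial

variable {K : Type*} [Field K] {d : ℤ} {ι : Type*}

/-- A zero at `y` would make X - y a common divisor of the entries. -/
theorem IsPrimitiveFamily.map_eval_ne_zero {B : Matrix (Fin 3) (Fin 3) K[X]}
    (hB : IsPrimitiveFamily fun p : Fin 3 × Fin 3 => B p.1 p.2) (y : K) : B.map (eval y) ≠ 0 := by
  intro h
  refine not_isUnit_X_sub_C y (hB _ fun p => dvd_iff_isRoot.mpr ?_)
  exact congrFun (congrFun h p.1) p.2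

/-- Primitivity gives G = fB with a polynomial f. A root of f would be a zero of G, so f is
constant. -/
theorem exists_eq_smul_of_proportional [IsAlgClosed K] [Infinite ι] {x : ι → K}
    (hx : Function.Injective x) {B G : Matrix (Fin 3) (Fin 3) K[X]}
    (hB : IsPrimitiveFamily fun p : Fin 3 × Fin 3 => B p.1 p.2)
    (hG : ∀ y, G.map (eval y) ≠ 0)
    (h : ∀ s, ∃ c : K, G.map (eval (x s)) = c • B.map (eval (x s))) :
    ∃ c : K, ∀ y, G.map (eval y) = c • B.map (eval y) := by
  obtain ⟨f, hf⟩ := hB.exists_eq_mul (g := fun p : Fin 3 × Fin 3 => G p.1 p.2) fun p q => by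
    rw [← sub_eq_zero]
    refine eq_zero_of_forall_eval_eq_zero hx fun s => ?_
    obtain ⟨c, hc⟩ := h s
    have hc' : ∀ i k, (G i k).eval (x s) = c * (B i k).eval (x s) := fun i k =>
      congrFun (congrFun hc i) k
    simp only [eval_sub, eval_mul, hc']
    ring
  have hGf : ∀ y, G.map (eval y) = f.eval y • B.map (eval y) := by
    intro y
    ext i k
    simp [hf (i, k)]
  have hdeg : f.degree = 0 := by
    by_contra h0
    obtain ⟨y, hy⟩ := IsAlgClosed.exists_root f h0
    exact hG y (by rw [hGf, hy.eq_zero, zero_smul])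
  refine ⟨f.coeff 0, fun y => ?_⟩
  rw [hGf, eq_C_of_degree_eq_zero hdeg]
  simp

/-- A normalized primitive lift of an action along a polynomial curve through the identity. -/
theorem AlgAction.exists_normalized_matrix [IsAlgClosed K] [CharZero K] [Infinite ι]
    (a : AlgAction K d) {x : ι → K} (hx : Function.Injective x) {c : ι → Gd K d}
    (hc : IsPolynomialCurve x c) {s₁ : ι} (hs₁ : c s₁ = 1) :
    ∃ B : Matrix (Fin 3) (Fin 3) K[X],
      IsPrimitiveFamily (fun p : Fin 3 × Fin 3 => B p.1 p.2) ∧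
      B.map (eval (x s₁)) = 1 ∧ ∀ s, IsGivenBy (a.toHom (c s)) (B.map (eval (x s))) := by
  have : Nonempty ι := ⟨s₁⟩
  obtain ⟨B, hB, h⟩ := a.exists_primitive_matrix hx hc
  have h1 := h s₁
  rw [hs₁, map_one] at h1
  obtain ⟨e, he, he'⟩ := h1.exists_smul isGivenBy_one
  have hmap : ∀ y, (Matrix.of fun i k => C e * B i k).map (eval y) = e • B.map (eval y) := by
    intro y
    ext i k
    simp
  refine ⟨Matrix.of fun i k => C e * B i k, fun q hq => hB q fun p => ?_, ?_, fun s => ?_⟩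
  · have : IsUnit (C e) := isUnit_C.mpr he.isUnit
    exact (this.dvd_mul_left).mp (hq p)
  · rw [hmap, he']
  · rw [hmap]
    exact (h s).of_smul he

theorem map_eval_comp (B : Matrix (Fin 3) (Fin 3) K[X]) (σ : K[X]) (y : K) :
    (B.map fun p => p.comp σ).map (eval y) = B.map (eval (σ.eval y)) := by
  ext i k
  simp

theorem map_eval_mul (A B : Matrix (Fin 3) (Fin 3) K[X]) (y : K) :
    (A * B).map (eval y) = A.map (eval y) * B.map (eval y) :=
  Matrix.map_mul (f := evalRingHom y)

theorem map_eval_map_C (A : Matrix (Fin 3) (Fin 3) K) (y : K) :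
    (A.map C).map (eval y) = A := by
  ext i k
  simp

/-- Here σ is the reparametrization corresponding to right multiplication by `c s₂`. The matrices
B(σ(y))·B(x(s₂))⁻¹ and B(y) represent the same maps, so they differ by a constant, which is 1 by
evaluation at the identity. This turns a projective representation into a linear one. -/
theorem map_eval_translate [IsAlgClosed K] [Infinite ι] {a : AlgAction K d} {x : ι → K}
    (hx : Function.Injective x) {c : ι → Gd K d} {s₁ s₂ : ι} {B : Matrix (Fin 3) (Fin 3) K[X]}
    (hB : IsPrimitiveFamily fun p : Fin 3 × Fin 3 => B p.1 p.2) (hB₁ : B.map (eval (x s₁)) = 1)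
    (h : ∀ s, IsGivenBy (a.toHom (c s)) (B.map (eval (x s)))) {σ : K[X]}
    (hσ₁ : σ.eval (x s₁) = x s₂) (hσ : ∀ s, ∃ s', x s' = σ.eval (x s) ∧ c s' = c s * c s₂) (y : K) :
    B.map (eval (σ.eval y)) = B.map (eval y) * B.map (eval (x s₂)) := by
  set M := B.map (eval (x s₂)) with hM
  have hdet : IsUnit M.det := (h s₂).det_ne_zero.isUnit
  have hev : ∀ y, ((B.map fun p => p.comp σ) * (M⁻¹).map C).map (eval y) =
      B.map (eval (σ.eval y)) * M⁻¹ := by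
    intro y
    rw [map_eval_mul, map_eval_comp, map_eval_map_C]
  obtain ⟨e, he⟩ := exists_eq_smul_of_proportional hx hB
    (G := (B.map fun p => p.comp σ) * (M⁻¹).map C) (fun y h0 => by
      rw [hev] at h0
      apply hB.map_eval_ne_zero (σ.eval y)
      rw [← Matrix.nonsing_inv_mul_cancel_right M (B.map (eval (σ.eval y))) hdet, h0,
        Matrix.zero_mul]) (fun s => by
      obtain ⟨s', hs', hs''⟩ := hσ s
      have h1 := h s'
      rw [hs'', map_mul, hs'] at h1
      obtain ⟨e, -, he⟩ := ((h s).comp (h s₂)).exists_smul h1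
      refine ⟨e, ?_⟩
      rw [hev, he, Matrix.smul_mul, Matrix.mul_nonsing_inv_cancel_right _ _ hdet])
  have he1 := he (x s₁)
  rw [hev, hσ₁, ← hM, Matrix.mul_nonsing_inv _ hdet, hB₁] at he1
  have he2 : e = 1 := by simpa using (congrFun (congrFun he1 0) 0).symm
  have := he y
  rw [hev, he2, one_smul] at this
  rw [← this, Matrix.nonsing_inv_mul_cancel_right _ _ hdet]

theorem eval_aeval_unipotent (P : MvPolynomial (Fin 3) K) (b : K) :
    (MvPolynomial.aeval ![X, 1, 1] P).eval b = MvPolynomial.eval (⟨b, 1⟩ : Gd K d).coords P := by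
  rw [← coe_evalRingHom, MvPolynomial.map_aeval]
  simp only [MvPolynomial.coe_eval₂Hom, MvPolynomial.eval, Gd.coords]
  congr 1
  · ext r
    simp
  · funext k
    fin_cases k <;> simp

theorem isPolynomialCurve_unipotent :
    IsPolynomialCurve (fun b : K => b) fun b => (⟨b, 1⟩ : Gd K d) := fun P =>
  ⟨fun _ => 1, fun i => MvPolynomial.aeval ![X, 1, 1] (P i), fun b =>
    ⟨one_ne_zero, fun i => by rw [one_mul, eval_aeval_unipotent]⟩⟩

/-- A power of t clears the denominators. Allowing all large exponents lets several functions share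
the same power. -/
theorem exists_polynomial_torus (P : MvPolynomial (Fin 3) K) :
    ∃ n₀ : ℕ, ∀ n ≥ n₀, ∃ Q : K[X], ∀ t : Kˣ,
      Q.eval (t : K) = (t : K) ^ n * MvPolynomial.eval (⟨0, t⟩ : Gd K d).coords P := by
  induction P using MvPolynomial.induction_on with
  | C r => exact ⟨0, fun n _ => ⟨C r * X ^ n, fun t => by
      rw [eval_mul, eval_C, eval_pow, eval_X, MvPolynomial.eval_C, mul_comm]⟩⟩
  | add p q hp hq =>
    obtain ⟨n₁, h₁⟩ := hp
    obtain ⟨n₂, h₂⟩ := hq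
    refine ⟨max n₁ n₂, fun n hn => ?_⟩
    obtain ⟨Q₁, hQ₁⟩ := h₁ n (le_trans (le_max_left _ _) hn)
    obtain ⟨Q₂, hQ₂⟩ := h₂ n (le_trans (le_max_right _ _) hn)
    exact ⟨Q₁ + Q₂, fun t => by rw [eval_add, hQ₁, hQ₂, map_add, mul_add]⟩
  | mul_X p i hp =>
    obtain ⟨n₁, h₁⟩ := hp
    refine ⟨n₁ + 1, fun n hn => ?_⟩
    obtain ⟨m, rfl⟩ : ∃ m, n = m + 1 := ⟨n - 1, by omega⟩
    obtain ⟨Q, hQ⟩ := h₁ m (by omega)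
    fin_cases i
    · exact ⟨0, fun t => by simp [Gd.coords]⟩
    · exact ⟨Q * X ^ 2, fun t => by simp [hQ, Gd.coords]; ring⟩
    · refine ⟨Q, fun t => ?_⟩
      have h1 : (t : K) ^ (m + 1) * ((t⁻¹ : Kˣ) : K) = (t : K) ^ m := by
        rw [pow_succ, mul_assoc, Units.mul_inv, mul_one]
      rw [hQ, map_mul, MvPolynomial.eval_X, ← h1]
      change _ * ((t⁻¹ : Kˣ) : K) * _ = _ * (_ * ((t⁻¹ : Kˣ) : K))
      ring

theorem isPolynomialCurve_torus :
    IsPolynomialCurve (fun t : Kˣ => (t : K)) fun t => (⟨0, t⟩ : Gd K d) := by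
  intro P
  choose n hn using fun i => exists_polynomial_torus (d := d) (P i)
  choose Q hQ using fun i => hn i (∑ k, n k)
    (Finset.single_le_sum (f := n) (fun _ _ => Nat.zero_le _) (Finset.mem_univ i))
  exact ⟨fun t => (t : K) ^ ∑ k, n k, Q, fun t => ⟨pow_ne_zero _ t.ne_zero, fun i => hQ i t⟩⟩

theorem infinite_units [CharZero K] : Infinite Kˣ := by
  refine Infinite.of_injective
    (fun n : ℕ => Units.mk0 ((n : K) + 1) (Nat.cast_add_one_ne_zero n)) fun m n h => ?_
  simpa using congrArg Units.val h

/-- The characteristic polynomial is X³, and Cayley–Hamilton applies. -/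
theorem pow_three_eq_zero_of_isNilpotent {N : Matrix (Fin 3) (Fin 3) K} (hN : IsNilpotent N) :
    N ^ 3 = 0 := by
  have h := (Matrix.isNilpotent_charpoly_sub_pow_of_isNilpotent hN).eq_zero
  have h2 := Matrix.aeval_self_charpoly N
  rw [sub_eq_zero.mp h] at h2
  simpa using h2

/-- The one-parameter unipotent group generated by a matrix of nilpotency index at most three. -/
def unipotent (N : Matrix (Fin 3) (Fin 3) K) (b : K) : Matrix (Fin 3) (Fin 3) K :=
  1 + b • N + (b ^ 2 / 2) • N ^ 2

theorem trace_unipotent {N : Matrix (Fin 3) (Fin 3) K} (hN : N ^ 3 = 0) (b : K) :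
    (unipotent N b).trace = 3 := by
  have h1 : N.trace = 0 := (Matrix.isNilpotent_trace_of_isNilpotent ⟨3, hN⟩).eq_zero
  have h2 : (N ^ 2).trace = 0 := (Matrix.isNilpotent_trace_of_isNilpotent
    ⟨3, by rw [← pow_mul, mul_comm, pow_mul, hN, zero_pow two_ne_zero]⟩).eq_zero
  simp [unipotent, h1, h2]

/-- The relation (0,t)(b,1) = (t^d b,1)(0,t) lifts to matrices up to a scalar. Conjugate matrices
have equal trace and unipotent ones have trace 3 ≠ 0, so the scalar is 1. -/
theorem torus_mul_nilpotent [CharZero K] {a : AlgAction K d} {N : Matrix (Fin 3) (Fin 3) K} (hN : N ^ 3 = 0)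
    (hU : ∀ b, IsGivenBy (a.toHom ⟨b, 1⟩) (unipotent N b)) {t : Kˣ}
    {T : Matrix (Fin 3) (Fin 3) K} (hT : IsGivenBy (a.toHom ⟨0, t⟩) T) :
    T * N = ((t ^ d : Kˣ) : K) • (N * T) := by
  have key : ∀ b, unipotent N (((t ^ d : Kˣ) : K) * b) * T = T * unipotent N b := by
    intro b
    have h1 := hT.comp (hU b)
    have h2 := (hU (((t ^ d : Kˣ) : K) * b)).comp hT
    have h3 : (⟨0, t⟩ : Gd K d) * ⟨b, 1⟩ = ⟨((t ^ d : Kˣ) : K) * b, 1⟩ * ⟨0, t⟩ := by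
      ext <;> simp
    have h4 : (fun p => a.toHom ⟨0, t⟩ (a.toHom ⟨b, 1⟩ p)) =
        fun p => a.toHom ⟨((t ^ d : Kˣ) : K) * b, 1⟩ (a.toHom ⟨0, t⟩ p) := by
      funext p
      rw [← Equiv.Perm.mul_apply, ← map_mul, h3, map_mul, Equiv.Perm.mul_apply]
    rw [h4] at h1
    obtain ⟨c, -, hc⟩ := h1.exists_smul h2
    have hdet : IsUnit T.det := hT.det_ne_zero.isUnit
    have h5 : unipotent N (((t ^ d : Kˣ) : K) * b) = c • (T * unipotent N b * T⁻¹) := by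
      rw [← Matrix.smul_mul, ← hc, Matrix.mul_nonsing_inv_cancel_right _ _ hdet]
    have h6 := congrArg Matrix.trace h5
    rw [trace_unipotent hN, Matrix.trace_smul, Matrix.trace_mul_comm, ← Matrix.mul_assoc,
      Matrix.nonsing_inv_mul _ hdet, Matrix.one_mul, trace_unipotent hN, smul_eq_mul] at h6
    have h7 : c = 1 := mul_right_cancel₀ (three_ne_zero (α := K)) (by rw [← h6, one_mul])
    rw [hc, h7, one_smul]
  -- The difference of the cases b = 1 and b = -1 isolates the term linear in b.
  have h1 := key 1
  have h2 := key (-1)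
  simp only [unipotent, Matrix.add_mul, Matrix.mul_add, Matrix.smul_mul, Matrix.mul_smul] at h1 h2
  ext i k
  have h3 := congrFun (congrFun h1 i) k
  have h4 := congrFun (congrFun h2 i) k
  simp at h3 h4 ⊢
  linear_combination (h4 - h3) / 2

variable [IsAlgClosed K] [CharZero K]

/-- Multiplicativity, known on units, is a polynomial identity in y and so extends to all y; in this
form coefficients of powers of y can be compared. -/
theorem AlgAction.exists_torus_matrix (a : AlgAction K d) :
    ∃ T : Matrix (Fin 3) (Fin 3) K[X], T.map (eval 1) = 1 ∧
      (∀ t : Kˣ, IsGivenBy (a.toHom ⟨0, t⟩) (T.map (eval (t : K)))) ∧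
      ∀ (t : Kˣ) (y : K), T.map (eval ((t : K) * y)) = T.map (eval (t : K)) * T.map (eval y) := by
  have := infinite_units (K := K)
  have hx : Function.Injective fun t : Kˣ => (t : K) := Units.val_injective
  obtain ⟨T, hT, hT1, h⟩ := a.exists_normalized_matrix hx isPolynomialCurve_torus
    (s₁ := 1) rfl
  have hmul : ∀ s t : Kˣ, T.map (eval ((t : K) * s)) =
      T.map (eval (t : K)) * T.map (eval (s : K)) := by
    intro s t
    have := map_eval_translate hx hT hT1 h (σ := C (s : K) * X) (s₂ := s) (by simp)
      (fun t => ⟨s * t, by simp, by ext <;> simp [mul_comm]⟩) (t : K)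
    rwa [eval_mul, eval_C, eval_X, mul_comm] at this
  refine ⟨T, by simpa using hT1, h, fun t y => ?_⟩
  ext i k
  have h2 : (T i k).comp (C (t : K) * X) - ((T.map (eval (t : K))).map C * T) i k = 0 := by
    refine eq_zero_of_forall_eval_eq_zero hx fun s => ?_
    have := congrFun (congrFun (hmul s t) i) k
    simp only [Matrix.map_apply, Matrix.mul_apply] at this
    simp [Matrix.mul_apply, this, eval_finsetSum]
  have h3 := congrArg (eval y) h2
  simpa [Matrix.mul_apply, sub_eq_zero, eval_finsetSum] using h3

/-- Differentiating U(y + b) = U(y)U(b) at b = 0 gives U' = UN, so the coefficients of U are Nⁿ/n!.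
As U is a polynomial, N is nilpotent. -/
theorem AlgAction.exists_unipotent (a : AlgAction K d) :
    ∃ N : Matrix (Fin 3) (Fin 3) K, N ^ 3 = 0 ∧
      ∀ b, IsGivenBy (a.toHom ⟨b, 1⟩) (unipotent N b) := by
  have hx : Function.Injective fun b : K => b := fun _ _ h => h
  obtain ⟨U, hU, hU1, h⟩ := a.exists_normalized_matrix hx isPolynomialCurve_unipotent
    (s₁ := 0) rfl
  have hmul : ∀ b y : K, U.map (eval (y + b)) = U.map (eval y) * U.map (eval b) := by
    intro b y
    have := map_eval_translate hx hU hU1 h (σ := X + C b) (s₂ := b) (by simp)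
      (fun s => ⟨s + b, by simp, by ext <;> simp⟩) y
    simpa using this
  set N : Matrix (Fin 3) (Fin 3) K := U.map fun p => (derivative p).eval 0 with hN
  have hder : ∀ i k, derivative (U i k) = ∑ l, U i l * C (N l k) := by
    intro i k
    rw [← sub_eq_zero]
    refine eq_zero_of_forall_eval_eq_zero hx fun y => ?_
    have h1 : (U i k).comp (C y + X) = ∑ l, C ((U i l).eval y) * U l k := by
      rw [← sub_eq_zero]
      refine eq_zero_of_forall_eval_eq_zero hx fun b => ?_
      have := congrFun (congrFun (hmul b y) i) k
      simp only [Matrix.map_apply, Matrix.mul_apply] at this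
      simp [this, eval_finsetSum]
    have h2 := congrArg (fun p => (derivative p).eval 0) h1
    simp only [derivative_comp, derivative_sum, eval_finsetSum] at h2
    simp [eval_finsetSum] at h2 ⊢
    rw [h2, sub_eq_zero]
    simp [hN]
  have hcoe : ∀ n : ℕ, (U.map fun p => p.coeff n) = ((n.factorial : K)⁻¹) • N ^ n := by
    intro n
    induction n with
    | zero =>
      rw [pow_zero, Nat.factorial_zero, Nat.cast_one, inv_one, one_smul, ← hU1]
      ext i k
      simp [coeff_zero_eq_eval_zero]
    | succ n ih =>
      ext i k
      have h1 := congrArg (fun p => coeff p n) (hder i k)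
      simp only [coeff_derivative, finsetSum_coeff, coeff_mul_C] at h1
      have h2 : ∀ l, (U i l).coeff n = ((n.factorial : K)⁻¹) * (N ^ n) i l := fun l =>
        congrFun (congrFun ih i) l
      have h3 : ((n : K) + 1) ≠ 0 := Nat.cast_add_one_ne_zero n
      have h4 : (n.factorial : K) ≠ 0 := Nat.cast_ne_zero.mpr n.factorial_ne_zero
      simp only [h2] at h1
      rw [Matrix.map_apply, Matrix.smul_apply, pow_succ, Matrix.mul_apply, Nat.factorial_succ,
        smul_eq_mul, eq_div_of_mul_eq h3 h1]
      simp only [mul_assoc, ← Finset.mul_sum]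
      push_cast
      field_simp
  have hnil : IsNilpotent N := by
    -- This exponent exceeds the degree of every entry of U.
    refine ⟨∑ i, ∑ k, (U i k).natDegree + 1, ?_⟩
    have h1 := hcoe (∑ i, ∑ k, (U i k).natDegree + 1)
    have h2 : (U.map fun p => p.coeff (∑ i, ∑ k, (U i k).natDegree + 1)) = 0 := by
      ext i k
      refine coeff_eq_zero_of_natDegree_lt (Nat.lt_succ_of_le ?_)
      exact (Finset.single_le_sum (f := fun k => (U i k).natDegree) (fun _ _ => Nat.zero_le _)
        (Finset.mem_univ k)).trans (Finset.single_le_sum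
          (f := fun i => ∑ k, (U i k).natDegree) (fun _ _ => Nat.zero_le _) (Finset.mem_univ i))
    rw [h2] at h1
    refine (smul_eq_zero.mp h1.symm).resolve_left ?_
    exact inv_ne_zero (Nat.cast_ne_zero.mpr (Nat.factorial_ne_zero _))
  have hN3 := pow_three_eq_zero_of_isNilpotent hnil
  refine ⟨N, hN3, fun b => ?_⟩
  have : unipotent N b = U.map (eval b) := by
    have hc : ∀ n i k, (U i k).coeff n = ((n.factorial : K)⁻¹) * (N ^ n) i k := fun n i k =>
      congrFun (congrFun (hcoe n) i) k
    ext i k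
    have hdeg : (U i k).natDegree < 3 := by
      rw [Nat.lt_succ_iff, natDegree_le_iff_coeff_eq_zero]
      intro n hn
      rw [hc, pow_eq_zero_of_le hn hN3, Matrix.zero_apply, mul_zero]
    rw [Matrix.map_apply, eval_eq_sum_range' hdeg]
    simp only [hc, Finset.sum_range_succ, unipotent]
    simp [Nat.factorial]
    ring
  rw [this]
  exact h b

end OneParameter

/-! ### Weight vectors -/

section Weights

open Polynomial

variable {K : Type*} [Field K] {d : ℤ}

/-- The vector `v` is multiplied by `t ^ w` under the torus. -/
def IsWeightVector (T : Matrix (Fin 3) (Fin 3) K[X]) (w : ℤ) (v : Fin 3 → K) : Prop :=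
  ∀ t : Kˣ, T.map (eval (t : K)) *ᵥ v = ((t ^ w : Kˣ) : K) • v

/-- Comparing coefficients of yⁿ in T(ty) = T(t)T(y) gives T(t)Tₙ = tⁿTₙ. -/
theorem isWeightVector_coeff {T : Matrix (Fin 3) (Fin 3) K[X]}
    (hT : ∀ (t : Kˣ) (y : K), T.map (eval ((t : K) * y)) = T.map (eval (t : K)) * T.map (eval y))
    [Infinite K] (n : ℕ) (v : Fin 3 → K) :
    IsWeightVector T n ((T.map fun p => p.coeff n) *ᵥ v) := by
  intro t
  rw [Matrix.mulVec_mulVec, ← Matrix.smul_mulVec]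
  congr 1
  ext i k
  have h1 : (T i k).comp (C (t : K) * X) = ∑ l, C ((T i l).eval (t : K)) * T l k := by
    refine Polynomial.funext fun y => ?_
    have := congrFun (congrFun (hT t y) i) k
    simpa [Matrix.mul_apply, eval_finsetSum] using this
  have h2 := congrArg (fun p => p.coeff n) h1
  simp only [comp_C_mul_X_coeff, finsetSum_coeff, coeff_C_mul] at h2
  rw [Matrix.mul_apply, Matrix.smul_apply, Matrix.map_apply, zpow_natCast, Units.val_pow_eq_pow_val,
    smul_eq_mul, mul_comm, h2]
  rfl

/-- Since T(1) = 1, the vector is the sum of its weight components. This replaces a vector outside a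
subspace by a weight vector outside it. -/
theorem exists_coeff_mulVec_notMem {T : Matrix (Fin 3) (Fin 3) K[X]} (hT1 : T.map (eval 1) = 1)
    (S : Submodule K (Fin 3 → K)) {v : Fin 3 → K} (hv : v ∉ S) :
    ∃ n, (T.map fun p => p.coeff n) *ᵥ v ∉ S := by
  by_contra! h
  apply hv
  set m := ∑ i, ∑ k, (T i k).natDegree + 1
  have hm : ∀ i k, (T i k).natDegree < m := fun i k => Nat.lt_succ_of_le <|
    (Finset.single_le_sum (f := fun k => (T i k).natDegree) (fun _ _ => Nat.zero_le _)
      (Finset.mem_univ k)).trans (Finset.single_le_sum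
        (f := fun i => ∑ k, (T i k).natDegree) (fun _ _ => Nat.zero_le _) (Finset.mem_univ i))
  have h1 : v = ∑ n ∈ Finset.range m, (T.map fun p => p.coeff n) *ᵥ v := by
    rw [← Matrix.sum_mulVec]
    conv_lhs => rw [← Matrix.one_mulVec v, ← hT1]
    congr 1
    ext i k
    rw [Matrix.map_apply, eval_eq_sum_range' (hm i k), Matrix.sum_apply]
    simp
  rw [h1]
  exact S.sum_mem fun n _ => h n

theorem IsWeightVector.nilpotent {T : Matrix (Fin 3) (Fin 3) K[X]} {N : Matrix (Fin 3) (Fin 3) K}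
    (hTN : ∀ t : Kˣ, T.map (eval (t : K)) * N = ((t ^ d : Kˣ) : K) • (N * T.map (eval (t : K))))
    {w : ℤ} {v : Fin 3 → K} (hv : IsWeightVector T w v) : IsWeightVector T (w + d) (N *ᵥ v) := by
  intro t
  rw [Matrix.mulVec_mulVec, hTN, Matrix.smul_mulVec, ← Matrix.mulVec_mulVec, hv t,
    Matrix.mulVec_smul, smul_smul, zpow_add, Units.val_mul, mul_comm]

/-- The kernel of N is stable under the torus; the coefficients of the polynomial identity N·T(t)v =
0 show that it contains the weight components of v. -/
theorem mulVec_coeff_mulVec_eq_zero [CharZero K] {T : Matrix (Fin 3) (Fin 3) K[X]}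
    {N : Matrix (Fin 3) (Fin 3) K}
    (hTN : ∀ t : Kˣ, T.map (eval (t : K)) * N = ((t ^ d : Kˣ) : K) • (N * T.map (eval (t : K))))
    {v : Fin 3 → K} (hv : N *ᵥ v = 0) (n : ℕ) :
    N *ᵥ ((T.map fun p => p.coeff n) *ᵥ v) = 0 := by
  have := infinite_units (K := K)
  funext i
  have h1 : ∑ k, ∑ l, C (N i k) * (T k l * C (v l)) = 0 := by
    refine eq_zero_of_forall_eval_eq_zero (x := fun t : Kˣ => (t : K)) Units.val_injective
      fun t => ?_
    have h2 : N *ᵥ (T.map (eval (t : K)) *ᵥ v) = 0 := by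
      have h3 : ((t ^ d : Kˣ) : K) • (N *ᵥ (T.map (eval (t : K)) *ᵥ v)) = 0 := by
        rw [Matrix.mulVec_mulVec, ← Matrix.smul_mulVec, ← hTN, ← Matrix.mulVec_mulVec, hv,
          Matrix.mulVec_zero]
      exact (smul_eq_zero.mp h3).resolve_left (Units.ne_zero _)
    have h4 := congrFun h2 i
    simpa [Matrix.mulVec, dotProduct, eval_finsetSum, Finset.mul_sum] using h4
  have h2 := congrArg (fun p => p.coeff n) h1
  simpa [finsetSum_coeff, Matrix.mulVec, dotProduct, Finset.mul_sum] using h2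

/-- The matrix with three given columns. -/
def columns (u v w : Fin 3 → K) : Matrix (Fin 3) (Fin 3) K := Matrix.of fun i => ![u i, v i, w i]

theorem columns_mulVec (u v w x : Fin 3 → K) :
    columns u v w *ᵥ x = x 0 • u + x 1 • v + x 2 • w := by
  funext i
  simp [columns, Matrix.mulVec, dotProduct, Fin.sum_univ_three, mul_comm]

theorem mul_columns (A : Matrix (Fin 3) (Fin 3) K) (u v w : Fin 3 → K) :
    A * columns u v w = columns (A *ᵥ u) (A *ᵥ v) (A *ᵥ w) := by
  ext i k
  fin_cases k <;> simp [columns, Matrix.mul_apply, Matrix.mulVec, dotProduct]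

theorem det_columns_ne_zero {u v w : Fin 3 → K}
    (h : ∀ x y z : K, x • u + y • v + z • w = 0 → x = 0 ∧ y = 0 ∧ z = 0) :
    (columns u v w).det ≠ 0 := by
  intro h0
  obtain ⟨x, hx, hx0⟩ := Matrix.exists_mulVec_eq_zero_iff.mpr h0
  rw [columns_mulVec] at hx0
  obtain ⟨h1, h2, h3⟩ := h _ _ _ hx0
  apply hx
  funext i
  fin_cases i <;> assumption

theorem unipotent_mul_of_mul_eq {N P E : Matrix (Fin 3) (Fin 3) K} (h : N * P = P * E) (b : K) :
    unipotent N b * P = P * unipotent E b := by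
  have h2 : N ^ 2 * P = P * E ^ 2 := by
    rw [pow_two, pow_two, Matrix.mul_assoc, h, ← Matrix.mul_assoc, h, Matrix.mul_assoc]
  rw [unipotent, unipotent, Matrix.add_mul, Matrix.add_mul, Matrix.mul_add, Matrix.mul_add,
    Matrix.one_mul, Matrix.mul_one, Matrix.smul_mul, Matrix.smul_mul, Matrix.mul_smul,
    Matrix.mul_smul, h, h2]

end Weights

/-! ### Equivalence by a linear change of coordinates -/

section Conjugation

variable {K : Type*} [Field K] {d : ℤ}

theorem isGivenBy_linearHom (M : Gd K d →* Matrix (Fin 3) (Fin 3) K) (g : Gd K d) :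
    IsGivenBy (linearHom M g) (M g) :=
  fun v hv => ⟨mulVec_ne_zero M g v hv, linearHom_mk M g v hv _⟩

theorem IsGivenBy.isRegularPlaneMap {j : P2 K → P2 K} {A : Matrix (Fin 3) (Fin 3) K}
    (h : IsGivenBy j A) : IsRegularPlaneMap j := by
  have key : ∀ v : Fin 3 → K, (fun i => MvPolynomial.eval v
      (∑ k, MvPolynomial.C (A i k) * MvPolynomial.X k)) = A *ᵥ v := by
    intro v
    funext i
    simp [Matrix.mulVec, dotProduct]
  intro v₀ hv₀
  refine ⟨1, fun i => ∑ k, MvPolynomial.C (A i k) * MvPolynomial.X k, fun i =>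
    MvPolynomial.IsHomogeneous.sum _ _ _ fun k _ => MvPolynomial.isHomogeneous_C_mul_X _ _, ?_, ?_⟩
  · rw [key]
    exact (h v₀ hv₀).1
  · intro v hv hF
    obtain ⟨h1, h2⟩ := h v hv
    rw [h2]
    congr 1
    exact (key v).symm

theorem exists_equiv_isGivenBy {P : Matrix (Fin 3) (Fin 3) K} (hP : P.det ≠ 0) :
    ∃ j : P2 K ≃ P2 K, IsGivenBy j P⁻¹ ∧ IsGivenBy j.symm P := by
  have hP' : IsUnit P.det := hP.isUnit
  let G : GL (Fin 3) K := ⟨P, P⁻¹, Matrix.mul_nonsing_inv P hP', Matrix.nonsing_inv_mul P hP'⟩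
  refine ⟨MulAction.toPerm G⁻¹, fun v hv => ?_, fun v hv => ?_⟩
  · have h : P⁻¹ *ᵥ v ≠ 0 := fun h0 => hv (by
      rw [← Matrix.one_mulVec v, ← Matrix.mul_nonsing_inv P hP', ← Matrix.mulVec_mulVec, h0,
        Matrix.mulVec_zero])
    exact ⟨h, rfl⟩
  · have h : P *ᵥ v ≠ 0 := fun h0 => hP (Matrix.exists_mulVec_eq_zero_iff.mp ⟨v, hv, h0⟩)
    exact ⟨h, rfl⟩

theorem AlgAction.equivalent_of_conj {a a' : AlgAction K d} {α : Gd K d ≃* Gd K d}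
    (hα : IsRegularSelfMap α) (hα' : IsRegularSelfMap α.symm)
    {P : Matrix (Fin 3) (Fin 3) K} (hP : P.det ≠ 0)
    (h : ∀ g, ∃ (A A' : Matrix (Fin 3) (Fin 3) K) (c : K), IsGivenBy (a.toHom g) A ∧
      IsGivenBy (a'.toHom (α g)) A' ∧ c ≠ 0 ∧ A * P = c • (P * A')) :
    a.Equivalent a' := by
  obtain ⟨j, hj, hj'⟩ := exists_equiv_isGivenBy hP
  refine ⟨α, j, hα, hα', hj.isRegularPlaneMap, hj'.isRegularPlaneMap, fun g p => ?_⟩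
  obtain ⟨A, A', c, hA, hA', hc, hAP⟩ := h g
  have hP' : IsUnit P.det := hP.isUnit
  have h1 : P⁻¹ * A = c • (A' * P⁻¹) := by
    rw [← Matrix.mul_nonsing_inv_cancel_right P A hP', hAP, Matrix.smul_mul, Matrix.mul_smul,
      Matrix.mul_assoc, Matrix.nonsing_inv_mul_cancel_left _ _ hP']
  have h2 := hj.comp hA
  rw [h1] at h2
  exact congrFun (h2.ext ((hA'.comp hj).of_smul hc)) p

theorem isRegularSelfMap_refl : IsRegularSelfMap (MulEquiv.refl (Gd K d)) := fun _ hf => hf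

open Polynomial in
-- As (b,t) = (b,1)(0,t), the action is given by exp(bN)T(t), which the basis P turns into
-- exp(bE)D(t). The factor t^w is invisible projectively.
theorem AlgAction.equivalent_of_basis {a a' : AlgAction K d}
    {T : Matrix (Fin 3) (Fin 3) K[X]} {N E P : Matrix (Fin 3) (Fin 3) K}
    {D : Kˣ → Matrix (Fin 3) (Fin 3) K} {w : ℤ} {M : Gd K d →* Matrix (Fin 3) (Fin 3) K}
    (hN : ∀ b, IsGivenBy (a.toHom ⟨b, 1⟩) (unipotent N b))
    (hT : ∀ t : Kˣ, IsGivenBy (a.toHom ⟨0, t⟩) (T.map (eval (t : K))))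
    (ha' : a'.toHom = linearHom M) (hP : P.det ≠ 0) (hNP : N * P = P * E)
    (hTP : ∀ t : Kˣ, T.map (eval (t : K)) * P = P * D t)
    (hM : ∀ g : Gd K d, unipotent E g.b * D g.t = ((g.t ^ w : Kˣ) : K) • M g) :
    a.Equivalent a' := by
  refine equivalent_of_conj isRegularSelfMap_refl isRegularSelfMap_refl hP fun g =>
    ⟨unipotent N g.b * T.map (eval (g.t : K)), M g, ((g.t ^ w : Kˣ) : K), ?_, ?_,
      Units.ne_zero _, ?_⟩
  · have h1 : g = ⟨g.b, 1⟩ * ⟨0, g.t⟩ := by ext <;> simp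
    conv => enter [1]; rw [h1, map_mul]
    exact (hN g.b).comp (hT g.t)
  · rw [ha']
    exact isGivenBy_linearHom M g
  · rw [Matrix.mul_assoc, hTP, ← Matrix.mul_assoc, unipotent_mul_of_mul_eq hNP, Matrix.mul_assoc,
      hM, Matrix.mul_smul]

end Conjugation

/-! ### Classification up to equivalence -/

section Classification

open Polynomial

variable {K : Type*} [Field K] {d : ℤ}

theorem unipotent_mul_diagonal_tau (u w : ℤ) (g : Gd K d) :
    unipotent (columns 0 0 (Pi.single 1 1)) g.b *
      Matrix.diagonal ![((g.t ^ u : Kˣ) : K), ((g.t ^ (w + d) : Kˣ) : K), ((g.t ^ w : Kˣ) : K)] =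
      ((g.t ^ w : Kˣ) : K) • tauMatrix K d (u - w) g := by
  ext i k
  rw [Matrix.mul_diagonal]
  fin_cases i <;> fin_cases k <;>
    simp [unipotent, columns, tauMatrix, pow_two, Matrix.mul_apply, Fin.sum_univ_three,
      zpow_add₀, zpow_sub₀] <;> field_simp

theorem columns_mul_diagonal (u v w : Fin 3 → K) (x y z : K) :
    columns u v w * Matrix.diagonal ![x, y, z] = columns (x • u) (y • v) (z • w) := by
  ext i k
  rw [Matrix.mul_diagonal]
  fin_cases k <;> simp [columns, mul_comm]

variable [CharZero K]

theorem unipotent_mul_diagonal_rho (w : ℤ) (g : Gd K d) :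
    unipotent (columns 0 (Pi.single 0 1) (Pi.single 1 1)) g.b *
      Matrix.diagonal ![((g.t ^ (w + d + d) : Kˣ) : K), ((g.t ^ (w + d) : Kˣ) : K),
        ((g.t ^ w : Kˣ) : K)] = ((g.t ^ w : Kˣ) : K) • rhoMatrix K d g := by
  ext i k
  rw [Matrix.mul_diagonal]
  fin_cases i <;> fin_cases k <;>
    simp [unipotent, columns, rhoMatrix, pow_two, Matrix.mul_apply, Fin.sum_univ_three, two_mul,
      zpow_add₀] <;> ring

variable [IsAlgClosed K]

/-- A faithful action is equivalent to one of the model actions. -/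
theorem AlgAction.equivalent_rho_or_tau {a : AlgAction K d} (hf : a.Faithful) :
    a.Equivalent (rho K d) ∨ ∃ k, a.Equivalent (tau K d k) := by
  obtain ⟨N, hN3, hN⟩ := a.exists_unipotent
  obtain ⟨T, hT1, hT, hmul⟩ := a.exists_torus_matrix
  have hTN := fun t => torus_mul_nilpotent hN3 hN (hT t)
  have hN0 : N ≠ 0 := by
    rintro rfl
    have h1 : a.toHom ⟨1, 1⟩ = a.toHom ⟨0, 1⟩ := by
      apply Equiv.coe_fn_injective
      have h2 := hN 1
      have h3 := hN 0
      simp only [unipotent, smul_zero, zero_pow two_ne_zero] at h2 h3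
      exact h2.ext h3
    have h2 := congrArg Gd.b (hf h1)
    exact one_ne_zero h2
  by_cases hN2 : N ^ 2 = 0
  · right
    have hNN : ∀ v, N *ᵥ (N *ᵥ v) = 0 := fun v => by
      rw [Matrix.mulVec_mulVec, ← pow_two, hN2, Matrix.zero_mulVec]
    obtain ⟨v, hv⟩ : ∃ v, v ∉ LinearMap.ker N.mulVecLin := by
      by_contra! h
      exact hN0 (Matrix.mulVec_injective (funext fun v => by simpa using h v))
    obtain ⟨w, hw⟩ := exists_coeff_mulVec_notMem hT1 _ hv
    set e := (T.map fun p => p.coeff w) *ᵥ v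
    have he : IsWeightVector T w e := isWeightVector_coeff hmul w v
    have hNe : N *ᵥ e ≠ 0 := by simpa using hw
    -- Since N² = 0, the range lies in the kernel. If the kernel were the line spanned by Ne, rank
    -- and nullity would add up to at most 2.
    obtain ⟨v', hv', hv''⟩ : ∃ v', N *ᵥ v' = 0 ∧ v' ∉ Submodule.span K {N *ᵥ e} := by
      by_contra! h
      have h1 := LinearMap.finrank_range_add_finrank_ker N.mulVecLin
      have h2 : LinearMap.range N.mulVecLin ≤ LinearMap.ker N.mulVecLin := by
        rintro _ ⟨v, rfl⟩
        simpa using hNN v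
      have h3 := Submodule.finrank_mono h2
      have h4 : LinearMap.ker N.mulVecLin ≤ Submodule.span K {N *ᵥ e} := fun v hv =>
        h v (by simpa using hv)
      have h5 := Submodule.finrank_mono h4
      rw [finrank_span_singleton hNe] at h5
      simp at h1
      omega
    obtain ⟨u, hu⟩ := exists_coeff_mulVec_notMem hT1 _ hv''
    set f := (T.map fun p => p.coeff u) *ᵥ v'
    have hf' : IsWeightVector T u f := isWeightVector_coeff hmul u v'
    have hNf : N *ᵥ f = 0 := mulVec_coeff_mulVec_eq_zero hTN hv' u
    have hP : (columns f (N *ᵥ e) e).det ≠ 0 := by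
      apply det_columns_ne_zero
      intro x y z h
      have h1 := congrArg (fun v => N *ᵥ v) h
      simp only [Matrix.mulVec_add, Matrix.mulVec_smul, hNf, hNN, smul_zero, zero_add,
        Matrix.mulVec_zero] at h1
      have hz := (smul_eq_zero.mp h1).resolve_right hNe
      rw [hz, zero_smul, add_zero] at h
      have hx : x = 0 := by
        by_contra hx
        apply hu
        rw [Submodule.mem_span_singleton]
        refine ⟨-(x⁻¹ * y), ?_⟩
        rw [neg_smul, mul_smul, ← smul_neg, ← eq_neg_of_add_eq_zero_left h, inv_smul_smul₀ hx]
      rw [hx, zero_smul, zero_add] at h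
      exact ⟨hx, (smul_eq_zero.mp h).resolve_right hNe, hz⟩
    -- The basis f, Ne, e has weights u, w + d, w; dividing by t^w leaves the exponent u - w in the
    -- first place.
    refine ⟨u - w, equivalent_of_basis (w := w) hN hT rfl hP (E := columns 0 0 (Pi.single 1 1)) ?_
      (D := fun t => Matrix.diagonal ![((t ^ (u : ℤ) : Kˣ) : K), ((t ^ (w + d) : Kˣ) : K),
        ((t ^ (w : ℤ) : Kˣ) : K)]) (fun t => ?_) fun g => unipotent_mul_diagonal_tau u w g⟩
    · rw [mul_columns, mul_columns, hNf, hNN]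
      simp only [columns_mulVec]
      simp
    · rw [mul_columns, columns_mul_diagonal, hf' t, he t, he.nilpotent hTN t]
  · left
    have hNNN : ∀ v, N *ᵥ (N *ᵥ (N *ᵥ v)) = 0 := fun v => by
      rw [Matrix.mulVec_mulVec, Matrix.mulVec_mulVec, ← pow_three', hN3, Matrix.zero_mulVec]
    obtain ⟨v, hv⟩ : ∃ v, v ∉ LinearMap.ker (N ^ 2).mulVecLin := by
      by_contra! h
      exact hN2 (Matrix.mulVec_injective (funext fun v => by simpa using h v))
    obtain ⟨w, hw⟩ := exists_coeff_mulVec_notMem hT1 _ hv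
    set e := (T.map fun p => p.coeff w) *ᵥ v
    have he : IsWeightVector T w e := isWeightVector_coeff hmul w v
    have hNe : N *ᵥ (N *ᵥ e) ≠ 0 := by
      rw [Matrix.mulVec_mulVec, ← pow_two]
      simpa using hw
    -- A weight vector e with N²e ≠ 0 is cyclic for N; the weights of this basis are w + 2d, w + d,
    -- w.
    have hP : (columns (N *ᵥ (N *ᵥ e)) (N *ᵥ e) e).det ≠ 0 := by
      apply det_columns_ne_zero
      intro x y z h
      have h1 := congrArg (fun v => N *ᵥ (N *ᵥ v)) h
      simp only [Matrix.mulVec_add, Matrix.mulVec_smul, hNNN, smul_zero, zero_add,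
        Matrix.mulVec_zero] at h1
      have hz := (smul_eq_zero.mp h1).resolve_right hNe
      rw [hz, zero_smul, add_zero] at h
      have h2 := congrArg (fun v => N *ᵥ v) h
      simp only [Matrix.mulVec_add, Matrix.mulVec_smul, hNNN, smul_zero, zero_add,
        Matrix.mulVec_zero] at h2
      have hy := (smul_eq_zero.mp h2).resolve_right hNe
      rw [hy, zero_smul, add_zero] at h
      exact ⟨(smul_eq_zero.mp h).resolve_right hNe, hy, hz⟩
    refine equivalent_of_basis (w := w) hN hT rfl hP
      (E := columns 0 (Pi.single 0 1) (Pi.single 1 1)) ?_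
      (D := fun t => Matrix.diagonal ![((t ^ (w + d + d) : Kˣ) : K), ((t ^ (w + d) : Kˣ) : K),
        ((t ^ (w : ℤ) : Kˣ) : K)]) (fun t => ?_) fun g => unipotent_mul_diagonal_rho w g
    · rw [mul_columns, mul_columns, hNNN]
      simp only [columns_mulVec]
      simp
    · rw [mul_columns, columns_mul_diagonal, he t, he.nilpotent hTN t,
        (he.nilpotent hTN).nilpotent hTN t]

end Classification

/-! ### Invariance under equivalence -/

section Equivalence

variable {K : Type*} [Field K] {d : ℤ}

theorem AlgAction.Equivalent.symm {a a' : AlgAction K d} (h : a.Equivalent a') :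
    a'.Equivalent a := by
  obtain ⟨α, j, h1, h2, h3, h4, h5⟩ := h
  refine ⟨α.symm, j.symm, h2, h1, h4, h3, fun g p => ?_⟩
  rw [Equiv.symm_apply_eq, h5, MulEquiv.apply_symm_apply, Equiv.apply_symm_apply]

theorem AlgAction.Equivalent.faithful {a a' : AlgAction K d} (h : a.Equivalent a')
    (ha : a.Faithful) : a'.Faithful := by
  obtain ⟨α, j, -, -, -, -, h5⟩ := h
  intro g g' hgg
  apply α.symm.injective
  apply ha
  ext p : 1
  apply j.injective
  rw [h5, h5, MulEquiv.apply_symm_apply, MulEquiv.apply_symm_apply, hgg]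

variable [IsAlgClosed K] [CharZero K]

theorem AlgAction.Equivalent.trans {a a' a'' : AlgAction K d} (h : a.Equivalent a')
    (h' : a'.Equivalent a'') : a.Equivalent a'' := by
  obtain ⟨α, j, h1, h2, h3, h4, h5⟩ := h
  obtain ⟨α', j', h1', h2', h3', h4', h5'⟩ := h'
  obtain ⟨A, hA⟩ := GaGm.exists_isGivenBy j h3 h4
  obtain ⟨B, hB⟩ := GaGm.exists_isGivenBy j.symm h4 h3
  obtain ⟨A', hA'⟩ := GaGm.exists_isGivenBy j' h3' h4'
  obtain ⟨B', hB'⟩ := GaGm.exists_isGivenBy j'.symm h4' h3'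
  refine ⟨α.trans α', j.trans j', fun f hf => h1 _ (h1' f hf), fun f hf => h2' _ (h2 f hf),
    (hA'.comp hA).isRegularPlaneMap, (hB.comp hB').isRegularPlaneMap, fun g p => ?_⟩
  simp [h5, h5']

/-- An equivalence of linear actions is an intertwining matrix, up to scalars. -/
theorem exists_intertwining {a a' : AlgAction K d} {M M' : Gd K d →* Matrix (Fin 3) (Fin 3) K}
    (ha : a.toHom = linearHom M) (ha' : a'.toHom = linearHom M') (h : a.Equivalent a') :
    ∃ (α : Gd K d ≃* Gd K d) (J : Matrix (Fin 3) (Fin 3) K), IsRegularSelfMap α ∧ J.det ≠ 0 ∧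
      ∀ g, ∃ c : K, J * M g = c • (M' (α g) * J) := by
  obtain ⟨α, j, h1, h2, h3, h4, h5⟩ := h
  obtain ⟨J, hJ⟩ := GaGm.exists_isGivenBy j h3 h4
  refine ⟨α, J, h1, hJ.det_ne_zero, fun g => ?_⟩
  have h6 := hJ.comp (isGivenBy_linearHom M g)
  have h7 := (isGivenBy_linearHom M' (α g)).comp hJ
  rw [← ha] at h6
  rw [← ha'] at h7
  rw [← funext (h5 g)] at h7
  obtain ⟨c, -, hc⟩ := h7.exists_smul h6
  exact ⟨c, hc⟩

end Equivalence

/-! ### Automorphisms of `G_d` for `d ≠ 0` -/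

section Automorphisms

variable {K : Type*} [Field K] {d : ℤ}

/-- The character `(b, t) ↦ t` of `G_d`. -/
def torusProj : Gd K d →* Kˣ where
  toFun g := g.t
  map_one' := rfl
  map_mul' _ _ := rfl

/-- The torus `t ↦ (0, t)` of `G_d`. -/
def torusIncl : Kˣ →* Gd K d where
  toFun t := ⟨0, t⟩
  map_one' := rfl
  map_mul' s t := by ext <;> simp

theorem pow_natAbs_eq_of_zpow_eq {s t : Kˣ} {n : ℤ} (h : s ^ n = t ^ n) :
    s ^ n.natAbs = t ^ n.natAbs := by
  obtain ⟨m, rfl | rfl⟩ := n.eq_nat_or_neg <;> simpa using h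

variable [CharZero K]

theorem exists_unit_zpow_ne_one : ∃ t : Kˣ, ∀ n : ℤ, n ≠ 0 → ((t ^ n : Kˣ) : K) ≠ 1 := by
  refine ⟨Units.mk0 2 two_ne_zero, fun n hn h => hn ?_⟩
  have h1 : ((2 : ℚ) ^ n) = 1 := by
    have : (((2 : ℚ) ^ n : ℚ) : K) = ((1 : ℚ) : K) := by
      push_cast
      simpa using h
    exact_mod_cast this
  exact zpow_right_injective₀ (a := (2 : ℚ)) (by norm_num) (by norm_num) (by simpa using h1)

/-- For d ≠ 0 each (b,1) is a commutator: b = (t^d - 1)b' is solvable once t^d ≠ 1. Commutators die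
in the commutative torus quotient. -/
theorem map_unipotent_t (hd : d ≠ 0) (α : Gd K d ≃* Gd K d) (b : K) : (α ⟨b, 1⟩).t = 1 := by
  obtain ⟨t, ht⟩ := exists_unit_zpow_ne_one (K := K)
  have ht' : ((t ^ d : Kˣ) : K) - 1 ≠ 0 := sub_ne_zero.mpr (ht d hd)
  set b' := b / (((t ^ d : Kˣ) : K) - 1)
  have h1 : (⟨b, 1⟩ : Gd K d) * (⟨b', 1⟩ * ⟨0, t⟩) = ⟨0, t⟩ * ⟨b', 1⟩ := by
    ext
    · simp only [mul_b, one_zpow, Units.val_one, one_mul, mul_zero, add_zero, zero_add, b']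
      field_simp
      ring
    · simp
  have h2 := congrArg (fun g => (α g).t) h1
  simp only [map_mul, mul_t] at h2
  rw [mul_comm (α ⟨0, t⟩).t] at h2
  exact mul_eq_right.mp h2

/-- The function is polynomial and additive, so it agrees with a linear one on the natural numbers,
an infinite set in characteristic 0. -/
theorem map_unipotent_b (hd : d ≠ 0) {α : Gd K d ≃* Gd K d} (hα : IsRegularSelfMap α) (b : K) :
    (α ⟨b, 1⟩).b = b * (α ⟨1, 1⟩).b := by
  obtain ⟨P, hP⟩ := hα _ isRegularFun_b
  have hQ : ∀ b, (α ⟨b, 1⟩).b = (MvPolynomial.aeval ![Polynomial.X, 1, 1] P).eval b := fun b =>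
    (hP ⟨b, 1⟩).trans (eval_aeval_unipotent P b).symm
  have hadd : ∀ x y : K, (α ⟨x + y, 1⟩).b = (α ⟨x, 1⟩).b + (α ⟨y, 1⟩).b := by
    intro x y
    have : (⟨x + y, 1⟩ : Gd K d) = ⟨x, 1⟩ * ⟨y, 1⟩ := by ext <;> simp
    rw [this, map_mul, mul_b, map_unipotent_t hd, one_zpow, Units.val_one, one_mul]
  have hnat : ∀ n : ℕ, (α ⟨(n : K), 1⟩).b = n * (α ⟨1, 1⟩).b := by
    intro n
    induction n with
    | zero =>
      have := hadd 0 0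
      rw [add_zero] at this
      simpa using this
    | succ n ih =>
      rw [Nat.cast_succ, hadd, ih]
      ring
  have h0 : MvPolynomial.aeval ![Polynomial.X, 1, 1] P -
      Polynomial.X * Polynomial.C (α ⟨1, 1⟩).b = 0 :=
    eq_zero_of_forall_eval_eq_zero (x := fun n : ℕ => (n : K)) Nat.cast_injective fun n => by
      rw [Polynomial.eval_sub, ← hQ, hnat, Polynomial.eval_mul, Polynomial.eval_X,
        Polynomial.eval_C, sub_self]
  rw [hQ, sub_eq_zero.mp h0, Polynomial.eval_mul, Polynomial.eval_X, Polynomial.eval_C]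

theorem map_unipotent_one_b_ne_zero (hd : d ≠ 0) (α : Gd K d ≃* Gd K d) :
    (α ⟨1, 1⟩).b ≠ 0 := by
  intro h0
  have h1 : α ⟨1, 1⟩ = 1 := by
    ext
    · exact h0
    · rw [map_unipotent_t hd, one_t]
  rw [map_eq_one_iff α α.injective] at h1
  exact one_ne_zero (congrArg Gd.b h1)

/-- Conjugation on the unipotent subgroup shows that the image of s has the same d-th power as s.
Writing t as an |d|-th power and using that the induced map is a homomorphism gives equality for t
itself. -/
theorem map_torus_t [IsAlgClosed K] (hd : d ≠ 0) {α : Gd K d ≃* Gd K d} (hα : IsRegularSelfMap α)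
    (t : Kˣ) : (α ⟨0, t⟩).t = t := by
  have hb := map_unipotent_one_b_ne_zero hd α
  have key : ∀ s : Kˣ, (α ⟨0, s⟩).t ^ d = s ^ d := by
    intro s
    have h1 : (⟨0, s⟩ : Gd K d) * ⟨1, 1⟩ = ⟨((s ^ d : Kˣ) : K), 1⟩ * ⟨0, s⟩ := by ext <;> simp
    have h2 := congrArg (fun g => (α g).b) h1
    simp only [map_mul, mul_b, map_unipotent_t hd, one_zpow, Units.val_one, one_mul] at h2
    rw [map_unipotent_b hd hα ((s ^ d : Kˣ) : K), add_comm] at h2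
    exact Units.ext (mul_right_cancel₀ hb (add_right_cancel h2))
  have hn : 0 < d.natAbs := Int.natAbs_pos.mpr hd
  obtain ⟨z, hz⟩ := IsAlgClosed.exists_pow_nat_eq (t : K) hn
  have hz0 : z ≠ 0 := by
    rintro rfl
    rw [zero_pow hn.ne'] at hz
    exact t.ne_zero hz.symm
  have hs : Units.mk0 z hz0 ^ d.natAbs = t := Units.ext (by simpa using hz)
  have h1 : (torusProj.comp (α.toMonoidHom.comp torusIncl)) (Units.mk0 z hz0) ^ d.natAbs =
      Units.mk0 z hz0 ^ d.natAbs := pow_natAbs_eq_of_zpow_eq (key _)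
  rw [← map_pow, hs] at h1
  exact h1

end Automorphisms

/-! ### The models are pairwise inequivalent -/

section Models

variable {K : Type*} [Field K] {d : ℤ} [CharZero K]

theorem scalar_eq_one_of_trace_eq_three {A B J : Matrix (Fin 3) (Fin 3) K} {c : K}
    (hJ : J.det ≠ 0) (h : J * A = c • (B * J)) (hA : A.trace = 3) (hB : B.trace = 3) : c = 1 := by
  have hJ' : IsUnit J.det := hJ.isUnit
  have h1 : A = c • (J⁻¹ * (B * J)) := by
    rw [← Matrix.mul_smul, ← h, Matrix.nonsing_inv_mul_cancel_left _ _ hJ']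
  have h2 := congrArg Matrix.trace h1
  rw [Matrix.trace_smul, Matrix.trace_mul_comm, Matrix.mul_nonsing_inv_cancel_right _ _ hJ', hA, hB,
    smul_eq_mul] at h2
  exact mul_right_cancel₀ (three_ne_zero (α := K)) (by rw [← h2, one_mul])

variable [IsAlgClosed K]

/-- Rows 0 and 2 of J are fixed by right multiplication by the matrix of (1,1) under ρ. That matrix
is a single Jordan block, so its fixed row vectors form a line, and J would be singular. -/
theorem not_equivalent_rho_tau (hd : d ≠ 0) (k : ℤ) : ¬ (rho K d).Equivalent (tau K d k) := by
  intro h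
  obtain ⟨α, J, hα, hJ, hc⟩ := exists_intertwining (M := rhoMatrix K d) (M' := tauMatrix K d k)
    rfl rfl h
  obtain ⟨c, hc⟩ := hc ⟨1, 1⟩
  have ht := map_unipotent_t hd α 1
  have hc1 : c = 1 := by
    refine scalar_eq_one_of_trace_eq_three hJ hc ?_ ?_
    · simp [rhoMatrix, Matrix.trace_fin_three]
      norm_num
    · simp [tauMatrix, Matrix.trace_fin_three, ht]
      norm_num
  rw [hc1, one_smul] at hc
  have e := fun i l => congrFun (congrFun hc i) l
  have e01 := e 0 1
  have e02 := e 0 2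
  have e21 := e 2 1
  have e22 := e 2 2
  simp [rhoMatrix, tauMatrix, Matrix.mul_apply, Fin.sum_univ_three, ht] at e01 e02 e21 e22
  rw [e01] at e02
  rw [e21] at e22
  simp at e02 e22
  apply hJ
  rw [Matrix.det_fin_three, e01, e02, e21, e22]
  ring

theorem eq_of_equivalent_tau_tau (hd : d ≠ 0) {k k' : ℤ}
    (h : (tau K d k).Equivalent (tau K d k')) : k = k' := by
  obtain ⟨α, J, hα, hJ, hc⟩ := exists_intertwining (M := tauMatrix K d k) (M' := tauMatrix K d k')
    rfl rfl h
  obtain ⟨t, ht⟩ := exists_unit_zpow_ne_one (K := K)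
  obtain ⟨c, h1⟩ := hc ⟨1, 1⟩
  obtain ⟨c', h2⟩ := hc ⟨0, t⟩
  have ht1 := map_unipotent_t hd α 1
  have ht2 := map_torus_t hd hα t
  have hc1 : c = 1 := by
    refine scalar_eq_one_of_trace_eq_three hJ h1 ?_ ?_
    · simp [tauMatrix, Matrix.trace_fin_three]
      norm_num
    · simp [tauMatrix, Matrix.trace_fin_three, ht1]
      norm_num
  rw [hc1, one_smul] at h1
  have e := fun i l => congrFun (congrFun h1 i) l
  -- These entries give J₀₁ = J₂₀ = J₂₁ = 0, so det J is the product of the diagonal entries. The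
  -- diagonal entries 0 and 2 of the torus relation then yield t^k = t^k'.
  have e02 := e 0 2
  have e10 := e 1 0
  have e11 := e 1 1
  have hb := map_unipotent_one_b_ne_zero hd α
  simp [tauMatrix, Matrix.mul_apply, Fin.sum_univ_three, ht1, hb] at e02 e10 e11
  have f00 := congrFun (congrFun h2 0) 0
  have f22 := congrFun (congrFun h2 2) 2
  simp [tauMatrix, Matrix.mul_apply, Matrix.vecMul, dotProduct, Fin.sum_univ_three, ht2] at f00 f22
  have hdet : J 0 0 * J 1 1 * J 2 2 ≠ 0 := by
    intro h0
    apply hJ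
    rw [Matrix.det_fin_three, e02, e10, e11]
    linear_combination h0
  have h00 : J 0 0 ≠ 0 := left_ne_zero_of_mul (left_ne_zero_of_mul hdet)
  have h22 : J 2 2 ≠ 0 := right_ne_zero_of_mul hdet
  have hc'1 : c' = 1 := mul_right_cancel₀ h22 (by rw [one_mul, ← f22])
  rw [hc'1, one_mul, mul_comm] at f00
  have h3 : (t : K) ^ k = (t : K) ^ k' := mul_right_cancel₀ h00 f00
  by_contra hne
  apply ht (k - k') (sub_ne_zero.mpr hne)
  rw [zpow_sub, Units.val_mul, Units.val_zpow_eq_zpow_val, h3, ← Units.val_zpow_eq_zpow_val,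
    Units.mul_inv]

end Models

/-! ### Faithfulness and generic transitivity of the models -/

section Transitivity

variable {K : Type*} [Field K] {d : ℤ}

theorem eq_one_of_faithful_linear {a : AlgAction K d} {M : Gd K d →* Matrix (Fin 3) (Fin 3) K}
    (ha : a.toHom = linearHom M) (hf : a.Faithful) {g : Gd K d} (hg : M g = 1) : g = 1 := by
  apply hf
  apply Equiv.coe_fn_injective
  have h1 := isGivenBy_linearHom M g
  rw [hg, ← ha] at h1
  rw [map_one]
  exact h1.ext isGivenBy_one

theorem isRegularSelfMap_inv_torus {α : Gd K 0 → Gd K 0} (hα : ∀ g, α g = ⟨g.b, g.t⁻¹⟩) :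
    IsRegularSelfMap α := by
  rintro f ⟨P, hP⟩
  refine ⟨MvPolynomial.rename ![0, 2, 1] P, fun g => ?_⟩
  refine (hP (α g)).trans ?_
  rw [MvPolynomial.eval_rename, hα]
  congr 2
  funext k
  fin_cases k <;> simp [Gd.coords]

/-- `G_0` is a direct product, so inverting the torus factor is an automorphism. -/
theorem tau_zero_neg_one_equivalent : (tau K 0 (-1)).Equivalent (tau K 0 1) := by
  let α : Gd K 0 ≃* Gd K 0 :=
    { toFun := fun g => ⟨g.b, g.t⁻¹⟩
      invFun := fun g => ⟨g.b, g.t⁻¹⟩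
      left_inv := fun g => by simp
      right_inv := fun g => by simp
      map_mul' := fun g h => by ext <;> simp [mul_comm] }
  refine AlgAction.equivalent_of_conj (α := α) (isRegularSelfMap_inv_torus fun _ => rfl)
    (isRegularSelfMap_inv_torus fun _ => rfl) (P := 1) (by simp) fun g =>
      ⟨_, _, 1, isGivenBy_linearHom (tauMatrix K 0 (-1)) g,
        isGivenBy_linearHom (tauMatrix K 0 1) (α g), one_ne_zero, ?_⟩
  rw [one_smul, Matrix.mul_one, Matrix.one_mul]
  ext i k
  fin_cases i <;> fin_cases k <;> simp [tauMatrix, α]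

variable [IsAlgClosed K] [CharZero K]

/-- A primitive root of unity of order gcd(k,d) acts trivially. If the gcd is 0, the whole torus
does. -/
theorem gcd_eq_one_of_faithful_tau {k : ℤ} (hf : (tau K d k).Faithful) :
    Nat.gcd k.natAbs d.natAbs = 1 := by
  have key : ∀ t : Kˣ, t ^ k = 1 → t ^ d = 1 → t = 1 := by
    intro t hk hd
    refine congrArg Gd.t (eq_one_of_faithful_linear (M := tauMatrix K d k) rfl hf
      (g := ⟨0, t⟩) ?_)
    ext i l
    fin_cases i <;> fin_cases l <;>
      simp [tauMatrix, hk, hd, -Units.val_zpow_eq_zpow_val]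
  set m := Nat.gcd k.natAbs d.natAbs with hm
  have hmk : (m : ℤ) ∣ k := Int.natCast_dvd.mpr (Nat.gcd_dvd_left _ _)
  have hmd : (m : ℤ) ∣ d := Int.natCast_dvd.mpr (Nat.gcd_dvd_right _ _)
  rcases Nat.eq_zero_or_pos m with h0 | hpos
  · exfalso
    rw [h0, Nat.cast_zero, zero_dvd_iff] at hmk hmd
    obtain ⟨t, ht⟩ := exists_unit_zpow_ne_one (K := K)
    have := key t (by rw [hmk, zpow_zero]) (by rw [hmd, zpow_zero])
    exact ht 1 one_ne_zero (by rw [this]; simp)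
  · have : NeZero m := ⟨hpos.ne'⟩
    have : NeZero (m : K) := ⟨Nat.cast_ne_zero.mpr hpos.ne'⟩
    obtain ⟨ζ, hζ⟩ := HasEnoughRootsOfUnity.exists_primitiveRoot K m
    obtain ⟨t, rfl⟩ := hζ.isUnit hpos.ne'
    have ht : t ^ m = 1 := Units.ext (by simpa using hζ.pow_eq_one)
    have hz : ∀ n : ℤ, (m : ℤ) ∣ n → t ^ n = 1 := by
      rintro _ ⟨n, rfl⟩
      rw [zpow_mul, zpow_natCast, ht, one_zpow]
    rw [key t (hz k hmk) (hz d hmd), Units.val_one] at hζ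
    exact hζ.unique IsPrimitiveRoot.one

/-- For k = 0 both x and z are invariant, so each orbit lies in a line. Its preimage under the
linear equivalence is a line containing the orbit, whose nonempty open complement contradicts
density. -/
theorem not_genericallyTransitive_of_equivalent_tau_zero {a : AlgAction K d}
    (h : a.Equivalent (tau K d 0)) : ¬ a.GenericallyTransitive := by
  rintro ⟨U, -, hU, p, rfl⟩
  obtain ⟨α, j, -, -, h3, h4, h5⟩ := h
  obtain ⟨J, hJ⟩ := GaGm.exists_isGivenBy j h3 h4
  obtain ⟨l, hl, hl'⟩ : ∃ l : Fin 3 → K, l ≠ 0 ∧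
      ∀ g, l ⬝ᵥ (tauMatrix K d 0 g *ᵥ (j p).rep) = 0 := by
    -- The form z₀x - x₀z would be zero at the point (0:1:0), where x = 0 serves instead.
    by_cases h0 : (j p).rep 0 = 0
    · refine ⟨![1, 0, 0], fun h => one_ne_zero (congrFun h 0), fun g => ?_⟩
      simp [dotProduct, Matrix.mulVec, Fin.sum_univ_three, tauMatrix, h0]
    · refine ⟨![(j p).rep 2, 0, -(j p).rep 0], fun h => h0 ?_, fun g => ?_⟩
      · simpa using congrFun h 2
      · simp [dotProduct, Matrix.mulVec, Fin.sum_univ_three, tauMatrix]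
        ring
  set m := l ᵥ* J with hm
  have hm0 : m ≠ 0 := by
    intro h0
    apply hl
    rw [← Matrix.vecMul_one l, ← Matrix.mul_nonsing_inv J hJ.det_ne_zero.isUnit,
      ← Matrix.vecMul_vecMul, ← hm, h0, Matrix.zero_vecMul]
  obtain ⟨i, hi⟩ := Function.ne_iff.mp hm0
  set F : MvPolynomial (Fin 3) K := ∑ k, MvPolynomial.C (m k) * MvPolynomial.X k with hF
  have hFe : ∀ v, MvPolynomial.eval v F = m ⬝ᵥ v := by
    intro v
    simp [hF, dotProduct]
  have hopen : @IsOpen (P2 K) (zariski K) {p : P2 K | MvPolynomial.eval p.rep F ≠ 0} :=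
    TopologicalSpace.isOpen_generateFrom_of_mem ⟨1, F,
      MvPolynomial.IsHomogeneous.sum _ _ _ fun k _ => MvPolynomial.isHomogeneous_C_mul_X _ _, rfl⟩
  have hs : (Pi.single i 1 : Fin 3 → K) ≠ 0 := by simp
  have hne : {p : P2 K | MvPolynomial.eval p.rep F ≠ 0}.Nonempty := by
    refine ⟨Projectivization.mk K _ hs, ?_⟩
    obtain ⟨e, he⟩ := Projectivization.exists_smul_eq_mk_rep K _ hs
    rw [Set.mem_ofPred_eq, ← he, hFe, Units.smul_def, dotProduct_smul, smul_eq_mul]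
    refine mul_ne_zero e.ne_zero ?_
    simpa using hi
  obtain ⟨_, hq, g, rfl⟩ :=
    (@dense_iff_inter_open (P2 K) (zariski K) _).mp hU _ hopen hne
  apply hq
  change MvPolynomial.eval (a.toHom g p).rep F = 0
  rw [hFe, hm, ← Matrix.dotProduct_mulVec]
  obtain ⟨h6, h7⟩ := hJ (a.toHom g p).rep (a.toHom g p).rep_nonzero
  obtain ⟨h8, h9⟩ := isGivenBy_linearHom (tauMatrix K d 0) (α g) (j p).rep (j p).rep_nonzero
  rw [Projectivization.mk_rep, h5] at h7
  rw [Projectivization.mk_rep] at h9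
  obtain ⟨e, he⟩ := (Projectivization.mk_eq_mk_iff' K _ _ h6 h8).mp (h7.symm.trans h9)
  rw [← he, dotProduct_smul, hl', smul_zero]

end Transitivity

/-! ### The open orbit of `ρ_d` -/

section Orbit

open MvPolynomial

variable {K : Type*} [Field K] {d : ℤ}

theorem eval_rep_mk_ne_zero_iff {n : ℕ} {F : MvPolynomial (Fin 3) K} (hF : F.IsHomogeneous n)
    {v : Fin 3 → K} (hv : v ≠ 0) :
    eval (Projectivization.mk K v hv).rep F ≠ 0 ↔ eval v F ≠ 0 := by
  obtain ⟨e, he⟩ := Projectivization.exists_smul_eq_mk_rep K _ hv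
  have h1 : eval ((e : K) • v) F = (e : K) ^ n * eval v F := by
    have h2 : (C (e : K) : MvPolynomial (Fin 3) K) ^ n * F = bind₁ (fun i => C (e : K) * X i) F := by
      ext m
      rw [coeff_bind₁_C_mul_X, ← C_pow, coeff_C_mul]
      by_cases hm : coeff m F = 0
      · rw [hm, mul_zero, mul_zero]
      · have h3 := hF hm
        rw [← h3, Finsupp.degree_eq_weight_one]
        rfl
    have h3 := congrArg (eval v) h2
    rw [eval_bind₁] at h3
    simp only [map_mul, map_pow, eval_C, eval_X] at h3
    exact h3.symm
  rw [← he, Units.smul_def, h1]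
  simp

theorem exists_basic_open_subset {U : Set (P2 K)} (hU : @IsOpen (P2 K) (zariski K) U) {p : P2 K}
    (hp : p ∈ U) : ∃ (n : ℕ) (F : MvPolynomial (Fin 3) K), F.IsHomogeneous n ∧
      eval p.rep F ≠ 0 ∧ {q : P2 K | eval q.rep F ≠ 0} ⊆ U := by
  induction hU with
  | basic U hU =>
    obtain ⟨n, F, hF, rfl⟩ := hU
    exact ⟨n, F, hF, hp, subset_rfl⟩
  | univ => exact ⟨0, 1, isHomogeneous_one _ _, by simp, Set.subset_univ _⟩
  | inter U V _ _ hU hV =>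
    obtain ⟨n, F, hF, hpF, hFU⟩ := hU hp.1
    obtain ⟨m, G, hG, hpG, hGV⟩ := hV hp.2
    refine ⟨n + m, F * G, hF.mul hG, by simpa using ⟨hpF, hpG⟩, fun q hq => ?_⟩
    rw [Set.mem_ofPred_eq, map_mul] at hq
    exact ⟨hFU (left_ne_zero_of_mul hq), hGV (right_ne_zero_of_mul hq)⟩
  | sUnion S _ ih =>
    obtain ⟨V, hV, hpV⟩ := hp
    obtain ⟨n, F, hF, hpF, hFV⟩ := ih V hV hpV
    exact ⟨n, F, hF, hpF, hFV.trans (Set.subset_sUnion_of_mem hV)⟩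

/-- A product of nonzero forms is nonzero, hence nonzero at some vector over an infinite field; the
factor `X 0` keeps that vector away from 0. -/
theorem dense_basic_open [Infinite K] {n : ℕ} {F : MvPolynomial (Fin 3) K}
    (hF : F.IsHomogeneous n) (hF0 : F ≠ 0) :
    @Dense (P2 K) (zariski K) {q : P2 K | eval q.rep F ≠ 0} := by
  rw [@dense_iff_inter_open (P2 K) (zariski K)]
  rintro U hU ⟨p, hp⟩
  obtain ⟨m, G, hG, hpG, hGU⟩ := exists_basic_open_subset hU hp
  have hG0 : G ≠ 0 := by
    rintro rfl
    simp at hpG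
  have h0 : F * G * X 0 ≠ 0 := mul_ne_zero (mul_ne_zero hF0 hG0) (X_ne_zero 0)
  obtain ⟨v, hv⟩ : ∃ v, eval v (F * G * X 0) ≠ 0 := by
    by_contra! h
    exact h0 (MvPolynomial.funext fun v => by rw [h v, map_zero])
  simp only [map_mul, eval_X] at hv
  have hv0 : v ≠ 0 := fun h => right_ne_zero_of_mul hv (congrFun h 0)
  refine ⟨Projectivization.mk K v hv0, hGU ?_, ?_⟩
  · exact (eval_rep_mk_ne_zero_iff hG hv0).mpr (right_ne_zero_of_mul (left_ne_zero_of_mul hv))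
  · exact (eval_rep_mk_ne_zero_iff hF hv0).mpr (left_ne_zero_of_mul (left_ne_zero_of_mul hv))

/-- The equation of the union of the line and the conic. -/
noncomputable def boundaryForm (K : Type*) [Field K] : MvPolynomial (Fin 3) K :=
  X 2 * (X 1 ^ 2 - C 2 * X 0 * X 2)

theorem isHomogeneous_boundaryForm : (boundaryForm K).IsHomogeneous (1 + 2) := by
  refine (isHomogeneous_X K 2).mul (((isHomogeneous_X K 1).pow 2).sub ?_)
  exact (isHomogeneous_C_mul_X (2 : K) 0).mul (isHomogeneous_X K 2)

theorem compl_line_union_conic :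
    (line K ∪ conic K)ᶜ = {p : P2 K | eval p.rep (boundaryForm K) ≠ 0} := by
  ext p
  simp [line, conic, boundaryForm, sub_eq_zero]

theorem line_inter_conic : line K ∩ conic K = {pointX K} := by
  ext p
  have hv : (![1, 0, 0] : Fin 3 → K) ≠ 0 := fun h => one_ne_zero (congrFun h 0)
  simp only [Set.mem_inter_iff, line, conic, Set.mem_ofPred_eq, Set.mem_singleton_iff]
  constructor
  · rintro ⟨h2, h1⟩
    rw [h2, mul_zero, sq_eq_zero_iff] at h1
    rw [← p.mk_rep, pointX, mk_eq_mk_iff_cross]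
    intro i j
    fin_cases i <;> fin_cases j <;> simp [h1, h2]
  · rintro rfl
    obtain ⟨e, he⟩ := Projectivization.exists_smul_eq_mk_rep K _ hv
    rw [pointX, ← he]
    simp [Units.smul_def]

variable [IsAlgClosed K]

theorem exists_zpow_eq {n : ℤ} (hn : n ≠ 0) {x : K} (hx : x ≠ 0) :
    ∃ t : Kˣ, ((t ^ n : Kˣ) : K) = x := by
  have hpos : 0 < n.natAbs := Int.natAbs_pos.mpr hn
  obtain ⟨z, hz⟩ := IsAlgClosed.exists_pow_nat_eq x hpos
  have hz0 : z ≠ 0 := by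
    rintro rfl
    rw [zero_pow hpos.ne'] at hz
    exact hx hz.symm
  obtain ⟨m, rfl | rfl⟩ := n.eq_nat_or_neg
  · exact ⟨Units.mk0 z hz0, by simpa using hz⟩
  · exact ⟨(Units.mk0 z hz0)⁻¹, by simpa using hz⟩

variable [CharZero K]

/-- The orbit of (1:0:1) consists of the points (t^{2d} + b²/2 : b : 1), where the boundary form
equals -2t^{2d}. Conversely b = y/z and t^{2d} = x/z - (y/z)²/2 can be solved off the line and the
conic. -/
theorem rho_isDenseOpenOrbit (hd : d ≠ 0) :
    (rho K d).IsDenseOpenOrbit (line K ∪ conic K)ᶜ := by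
  have hv : (![1, 0, 1] : Fin 3 → K) ≠ 0 := fun h => one_ne_zero (congrFun h 0)
  have hF0 : boundaryForm K ≠ 0 := fun h => by
    have := congrArg (eval ![1, 0, 1]) h
    simp [boundaryForm] at this
  refine ⟨?_, ?_, Projectivization.mk K _ hv, ?_⟩
  · rw [compl_line_union_conic]
    exact TopologicalSpace.isOpen_generateFrom_of_mem ⟨_, _, isHomogeneous_boundaryForm, rfl⟩
  · rw [compl_line_union_conic]
    exact dense_basic_open isHomogeneous_boundaryForm hF0
  · have key : ∀ g : Gd K d, rhoMatrix K d g *ᵥ ![1, 0, 1] =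
        ![((g.t ^ (2 * d) : Kˣ) : K) + g.b ^ 2 / 2, g.b, 1] := by
      intro g
      funext i
      fin_cases i <;> simp [rhoMatrix, Matrix.mulVec, dotProduct, Fin.sum_univ_three]
    rw [compl_line_union_conic]
    ext p
    constructor
    · intro hp
      rw [Set.mem_ofPred_eq, boundaryForm] at hp
      simp only [map_mul, map_sub, map_pow, eval_X, eval_C] at hp
      have h2 : p.rep 2 ≠ 0 := left_ne_zero_of_mul hp
      have hx : p.rep 0 / p.rep 2 - (p.rep 1 / p.rep 2) ^ 2 / 2 ≠ 0 := by
        intro h0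
        apply right_ne_zero_of_mul hp
        field_simp at h0
        linear_combination -h0
      obtain ⟨t, ht⟩ := exists_zpow_eq (mul_ne_zero two_ne_zero hd) hx
      refine ⟨⟨p.rep 1 / p.rep 2, t⟩, ?_⟩
      obtain ⟨h3, h4⟩ := isGivenBy_linearHom (rhoMatrix K d) ⟨p.rep 1 / p.rep 2, t⟩ _ hv
      refine h4.trans ?_
      conv_rhs => rw [← p.mk_rep]
      rw [Projectivization.mk_eq_mk_iff']
      refine ⟨(p.rep 2)⁻¹, ?_⟩
      rw [key, ht]
      funext i
      fin_cases i <;> simp [h2] <;> field_simp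
    · rintro ⟨g, rfl⟩
      obtain ⟨h3, h4⟩ := isGivenBy_linearHom (rhoMatrix K d) g _ hv
      change eval (linearHom (rhoMatrix K d) g _).rep _ ≠ 0
      rw [h4, eval_rep_mk_ne_zero_iff isHomogeneous_boundaryForm, key]
      simp only [boundaryForm, map_mul, map_sub, map_pow, eval_X, eval_C]
      simp only [Matrix.cons_val]
      have : (1 : K) * (g.b ^ 2 - 2 * (((g.t ^ (2 * d) : Kˣ) : K) + g.b ^ 2 / 2) * 1) =
          -2 * ((g.t ^ (2 * d) : Kˣ) : K) := by ring
      rw [this]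
      exact mul_ne_zero (neg_ne_zero.mpr two_ne_zero) (Units.ne_zero _)

end Orbit

end GaGm

theorem theorem3p3 (K : Type*) [Field K] [IsAlgClosed K] [CharZero K] :
    (∀ d : ℤ, d ≠ 0 → ∀ a : GaGm.AlgAction K d, a.Faithful → a.GenericallyTransitive →
      ((∃! k : ℤ, k ≠ 0 ∧ Nat.gcd k.natAbs d.natAbs = 1 ∧ a.Equivalent (GaGm.tau K d k)) ∧
          ¬ a.Equivalent (GaGm.rho K d)) ∨
        (a.Equivalent (GaGm.rho K d) ∧
          ∀ k : ℤ, k ≠ 0 → ¬ a.Equivalent (GaGm.tau K d k))) ∧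
    (∀ d : ℤ, d ≠ 0 →
      (GaGm.rho K d).IsDenseOpenOrbit (GaGm.line K ∪ GaGm.conic K)ᶜ ∧
        GaGm.line K ∩ GaGm.conic K = {GaGm.pointX K}) ∧
    (∀ a : GaGm.AlgAction K 0, a.Faithful → a.GenericallyTransitive →
      a.Equivalent (GaGm.tau K 0 1)) := by
  refine ⟨fun d hd a hf hg => ?_, fun d hd => ⟨GaGm.rho_isDenseOpenOrbit hd, GaGm.line_inter_conic⟩,
    fun a hf _ => ?_⟩
  · rcases GaGm.AlgAction.equivalent_rho_or_tau hf with h | ⟨k, h⟩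
    · exact Or.inr ⟨h, fun k _ h' => GaGm.not_equivalent_rho_tau hd k (h.symm.trans h')⟩
    · refine Or.inl ⟨⟨k, ⟨?_, GaGm.gcd_eq_one_of_faithful_tau (h.faithful hf), h⟩, ?_⟩, fun h' =>
        GaGm.not_equivalent_rho_tau hd k (h'.symm.trans h)⟩
      · rintro rfl
        exact GaGm.not_genericallyTransitive_of_equivalent_tau_zero h hg
      · rintro k' ⟨-, -, h'⟩
        exact GaGm.eq_of_equivalent_tau_tau hd (h'.symm.trans h)
  · rcases GaGm.AlgAction.equivalent_rho_or_tau hf with h | ⟨k, h⟩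
    -- For d = 0 the matrix ρ(0,t) is the identity for every t.
    · exfalso
      obtain ⟨t, ht⟩ := GaGm.exists_unit_zpow_ne_one (K := K)
      have h1 := GaGm.eq_one_of_faithful_linear (M := GaGm.rhoMatrix K 0) rfl (h.faithful hf)
        (g := ⟨0, t⟩) (by
          ext i l
          fin_cases i <;> fin_cases l <;> simp [GaGm.rhoMatrix])
      refine ht 1 one_ne_zero ?_
      rw [zpow_one]
      exact congrArg (fun g => (g.t : K)) h1
    -- With d = 0 the gcd is |k|, so k = ±1.
    · have h1 := GaGm.gcd_eq_one_of_faithful_tau (h.faithful hf)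
      rw [Int.natAbs_zero, Nat.gcd_zero_right] at h1
      rcases Int.natAbs_eq k with h2 | h2
      · rw [h1] at h2
        rwa [h2] at h
      · rw [h1] at h2
        rw [h2] at h
        exact h.trans GaGm.tau_zero_neg_one_equivalent
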